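/- Let $n\ge 1$ and let $G$ be a graph on $[n]=\{1,\dots,n\}$. Let $\mathrm{Shi}(G)$ (resp. $\mathrm{Ish}(G)$) be the arrangement in $\mathbb R^n$ of the hyperplanes $x_i-x_j=0$ for $1\le i<j\le n$ together with $x_i-x_j=1$ (resp. $x_1-x_j=i$) for all edges $i<j$ of $G$. Regions are the connected components of the complement. A ceiling of a region $R$ is a hyperplane of the arrangement that does not contain the origin, is the affine span of a facet of $R$, and does not separate $R$ from the origin. The ceiling partition of $R$ is the set partition of $[n]$ generated by $i\sim j$ whenever $i<j$ and $x_i-x_j=1$ (resp. $x_1-x_j=i$) is a ceiling of $R$. $R$ is dominant if $x_1>\dots>x_n$ on $R$. For each region $R$ let $\pi=\pi_1\cdots\pi_n$ be the permutation with $x_{\pi_1}>\dots>x_{\pi_n}$ on $R$. An arc of a set partition of $[n]$ is a pair $i<j$ of consecutive elements of one of its blocks; the position partition of a word $w$ is given by $i\sim j\iff w_i=w_j$. * *The map $\hat\rho$.* Let $\hat B_n=\{(i,j):1\le i\le n,\ 1\le j\le n+i-1\}$ ($i$ is the column, $j$ the row), and let $\hat B_n(G)$ be obtained by deleting the squares $(j,n+i)$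 for which $i<j$ is not an edge of $G$. A valid placement on $\hat B_n(G)$ is an inclusion-maximal set of pairwise non-attacking rooks such that every row below the rook in column $1$ contains a rook. For a region $R$ of $\mathrm{Ish}(G)$, $\hat\rho(R)$ has one rook in each column $i$: in square $(i,n+d)$ if $x_1-x_i=d$ is a ceiling of $R$ with $1\le d<i$ (there is at most one such $d$), and in square $(i,\pi^{-1}_i)$ if there is no such ceiling. * *The map $\lambda$ (vertical lasers).* In a valid placement, each rook in a square $(j,n+i)$ with $i\ge 1$ fires a laser downwards, which ends in the row of the rook in column $i$ if that row is at most $n$, and otherwise in the row where the laser of the rook in column $i$ ends. $\lambda$ sends the placement to the word $w_1\cdots w_n$, where $w_i$ is the number of squares of column $i$ that are weakly below its rook and, if this rook fires a laser, weakly below the endpoint of the laser. * *The map $\beta$.* A parking function is a word in $[n]^n$ whose nondecreasing rearrangement $a_1\le\dots\le a_n$ satisfies $a_i\le i$ for all $i$. A rook word is a word $w\in[n]^n$ such that every integer in $[1,w_1]$ occurs among its letters. $\mathbb Z_{n+1}$ acts on $[n+1]^n$ by adding a constant to all letters modulo $n+1$; $\beta$ sends a rook word to the unique parking function in its orbit.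 * *The map $\omega$.* For a region $R$ of $\mathrm{Shi}(G)$ let $\Pi$ be the partition of $[n]$ generated by $i\sim j$ whenever $x_{\pi_i}-x_{\pi_j}=1$ is a ceiling of $R$, and label $R$ by the word $w_1\cdots w_n$ in which $w_i$ is the smallest element of the block of $\Pi$ containing $\pi^{-1}_i$. $\omega$ is the inverse of this labelling. **Theorem.** The following hold. 1. $\hat\rho$ is a bijection from the regions of $\mathrm{Ish}(G)$ to the valid placements on $\hat B_n(G)$; $\lambda$ is a bijection from these to the rook words all of whose position-partition arcs are edges of $G$; the $\mathbb Z_{n+1}$-orbit of every rook word contains exactly one parking function, and $\beta$ is a bijection from the rook words just described to the parking functions all of whose position-partition arcs are edges of $G$; and the labelling inverse to $\omega$ is a bijection from the regions of $\mathrm{Shi}(G)$ to these parking functions. 2. The composition $\omega\circ\beta\circ\lambda\circ\hat\rho$ is a bijection from the regions of $\mathrm{Ish}(G)$ to the regions of $\mathrm{Shi}(G)$. For every region $R$ of $\mathrm{Ish}(G)$, the image of $R$ has the same ceiling partition as $R$, and it is dominant if and only if $R$ is dominant. -/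

import Mathlib

/-!  Conventions: the vertex set `[n] = {1, …, n}` is modelled by `Fin n`, the element `i : Fin n`
standing for the number `i + 1`.  Words are functions `Fin n → ℕ` whose letters are honest positive
integers, and squares of a board are pairs (column, row) of honest positive integers.  -/

namespace ShiIsh

open Set

section Arrangements

/-- The set `{x | x_i - x_j = c}`. -/
def hyper {n : ℕ} (i j : Fin n) (c : ℝ) : Set (Fin n → ℝ) := {x | x i - x j = c}

/-- The Coxeter (braid) arrangement. -/
def cox (n : ℕ) : Set (Set (Fin n → ℝ)) :=
  {H | ∃ i j : Fin n, i < j ∧ H = hyper i j 0}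

/-- The deleted Shi arrangement `Shi(G)`. -/
def shi {n : ℕ} (G : SimpleGraph (Fin n)) : Set (Set (Fin n → ℝ)) :=
  cox n ∪ {H | ∃ i j : Fin n, i < j ∧ G.Adj i j ∧ H = hyper i j 1}

/-- The deleted Ish arrangement `Ish(G)`, with hyperplanes `x_1 - x_j = i` for edges `i < j`. -/
def ish {n : ℕ} [NeZero n] (G : SimpleGraph (Fin n)) : Set (Set (Fin n → ℝ)) :=
  cox n ∪ {H | ∃ i j : Fin n, i < j ∧ G.Adj i j ∧ H = hyper 0 j ((i : ℝ) + 1)}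

/-- The regions of an arrangement: the connected components of the complement. -/
def regions {n : ℕ} (A : Set (Set (Fin n → ℝ))) : Set (Set (Fin n → ℝ)) :=
  {R | ∃ x ∈ (⋃₀ A)ᶜ, R = connectedComponentIn (⋃₀ A)ᶜ x}

/-- The (closed, nonempty) faces of `R`: intersections of the closure of `R` with hyperplanes
of the arrangement. -/
def IsFace {n : ℕ} (A : Set (Set (Fin n → ℝ))) (R F : Set (Fin n → ℝ)) : Prop :=
  F.Nonempty ∧ ∃ S ⊆ A, F = closure R ∩ ⋂₀ S

/-- A facet is a face of codimension one. -/
def IsFacet {n : ℕ} (A : Set (Set (Fin n → ℝ))) (R F : Set (Fin n → ℝ)) : Prop :=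
  IsFace A R F ∧ Module.finrank ℝ (vectorSpan ℝ F) + 1 = n

/-- The hyperplane `H` separates `R` from the point `p`. -/
def Separates {n : ℕ} (H R : Set (Fin n → ℝ)) (p : Fin n → ℝ) : Prop :=
  ∀ x ∈ R, (segment ℝ x p ∩ H).Nonempty

/-- `H` is a ceiling of the region `R`: a non-linear hyperplane of the arrangement which is the
affine span of a facet of `R` and does not separate `R` from the origin. -/
def IsCeiling {n : ℕ} (A : Set (Set (Fin n → ℝ))) (R H : Set (Fin n → ℝ)) : Prop :=
  H ∈ A ∧ (0 : Fin n → ℝ) ∉ H ∧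
    (∃ F, IsFacet A R F ∧ (affineSpan ℝ F : Set (Fin n → ℝ)) = H) ∧ ¬ Separates H R 0

/-- A region is dominant if `x_1 > ⋯ > x_n` on it. -/
def IsDominant {n : ℕ} (R : Set (Fin n → ℝ)) : Prop := ∀ x ∈ R, StrictAnti x

/-- The ceiling partition of a region of `Shi(G)` (set partitions are encoded as setoids). -/
def shiCeilingPartition {n : ℕ} (G : SimpleGraph (Fin n)) (R : Set (Fin n → ℝ)) :
    Setoid (Fin n) :=
  Relation.EqvGen.setoid fun i j => i < j ∧ IsCeiling (shi G) R (hyper i j 1)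

/-- The ceiling partition of a region of `Ish(G)`. -/
def ishCeilingPartition {n : ℕ} [NeZero n] (G : SimpleGraph (Fin n)) (R : Set (Fin n → ℝ)) :
    Setoid (Fin n) :=
  Relation.EqvGen.setoid fun i j => i < j ∧ IsCeiling (ish G) R (hyper 0 j ((i : ℝ) + 1))

/-- The permutation `π` with `x_{π_1} > ⋯ > x_{π_n}` on `R` (it exists and is unique for every
region of an arrangement that contains the Coxeter arrangement). -/
noncomputable def regionPerm {n : ℕ} (R : Set (Fin n → ℝ)) : Equiv.Perm (Fin n) :=
  Classical.epsilon fun p : Equiv.Perm (Fin n) => ∀ x ∈ R, StrictAnti (x ∘ p)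

end Arrangements

section Words

/-- `(i, j)` is an arc of the set partition `P`: `i < j` are consecutive elements of a block. -/
def IsArc {n : ℕ} (P : Setoid (Fin n)) (i j : Fin n) : Prop :=
  i < j ∧ P i j ∧ ∀ k, i < k → k < j → ¬ P i k

/-- Every arc of the position partition of `w` is an edge of `G`. -/
def ArcsIn {n : ℕ} (G : SimpleGraph (Fin n)) (w : Fin n → ℕ) : Prop :=
  ∀ i j, IsArc (Setoid.ker w) i j → G.Adj i j

/-- Parking functions of size `n`: words in `[n]` whose nondecreasing rearrangement
`a_1 ≤ ⋯ ≤ a_n` satisfies `a_i ≤ i`. -/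
def Park (n : ℕ) : Set (Fin n → ℕ) :=
  {w | (∀ i, 1 ≤ w i ∧ w i ≤ n) ∧
    ∃ s : Equiv.Perm (Fin n), Monotone (w ∘ s) ∧ ∀ i, w (s i) ≤ (i : ℕ) + 1}

/-- Rook words of size `n`: words in `[n]` in which every integer of `[1, w_1]` appears. -/
def Rook (n : ℕ) [NeZero n] : Set (Fin n → ℕ) :=
  {w | (∀ i, 1 ≤ w i ∧ w i ≤ n) ∧ ∀ a, 1 ≤ a → a ≤ w 0 → ∃ i, w i = a}

/-- Two words in `[n+1]^n` lie in the same orbit of `ℤ_{n+1}`, acting by adding a constant to all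
letters modulo `n + 1`. -/
def SameOrbit {n : ℕ} (v w : Fin n → ℕ) : Prop :=
  ∃ c : ℕ, ∀ i, v i + c ≡ w i [MOD n + 1]

/-- The cycle map: the parking function in the orbit of a word. -/
noncomputable def beta {n : ℕ} (v : Fin n → ℕ) : Fin n → ℕ :=
  Classical.epsilon fun w => w ∈ Park n ∧ SameOrbit v w

end Words

section Shi

/-- The second component of the Shi ceiling diagram `(π, Π)`: the partition of positions generated
by `i ∼ j` whenever `x_{π_i} - x_{π_j} = 1` is a ceiling. -/
def shiDiagramPartition {n : ℕ} (G : SimpleGraph (Fin n)) (R : Set (Fin n → ℝ)) :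
    Setoid (Fin n) :=
  Relation.EqvGen.setoid fun i j =>
    regionPerm R i < regionPerm R j ∧
      IsCeiling (shi G) R (hyper (regionPerm R i) (regionPerm R j) 1)

/-- The label of a Shi region: `w_i` is the minimal position in the block of `Π` that contains
the position of the letter `i` in `π`. -/
noncomputable def shiWord {n : ℕ} (G : SimpleGraph (Fin n)) (R : Set (Fin n → ℝ)) : Fin n → ℕ :=
  fun i => sInf {m : ℕ | ∃ b : Fin n,
    shiDiagramPartition G R b ((regionPerm R).symm i) ∧ m = (b : ℕ) + 1}

/-- The map `ω` from words to regions of `Shi(G)`: the inverse of the labelling `shiWord`. -/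
noncomputable def omega {n : ℕ} (G : SimpleGraph (Fin n)) :
    (Fin n → ℕ) → Set (Fin n → ℝ) :=
  Function.invFunOn (shiWord G) (regions (shi G))

end Shi

section IshRooks

/-- The second component of the Ish ceiling diagram `(π, ε)`: `ε_j = i` if `x_1 - x_{π_j} = i` is a
ceiling, and `ε_j = 0` if there is no such ceiling (`sInf ∅ = 0`). -/
noncomputable def ishDots {n : ℕ} [NeZero n] (G : SimpleGraph (Fin n)) (R : Set (Fin n → ℝ)) :
    Fin n → ℕ :=
  fun j => sInf {m : ℕ | ∃ i : Fin n, i < regionPerm R j ∧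
    IsCeiling (ish G) R (hyper 0 (regionPerm R j) ((i : ℝ) + 1)) ∧ m = (i : ℕ) + 1}

/-- The board with columns `1, …, n` in which column `i` has height `n + i - 1`. -/
def boardHat (n : ℕ) : Set (ℕ × ℕ) :=
  {p | 1 ≤ p.1 ∧ p.1 ≤ n ∧ 1 ≤ p.2 ∧ p.2 + 1 ≤ n + p.1}

/-- The subboard obtained by deleting the squares `(j, n + i)` for which `i < j` is not an edge. -/
def boardHatOf {n : ℕ} (G : SimpleGraph (Fin n)) : Set (ℕ × ℕ) :=
  {p | p ∈ boardHat n ∧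
    ∀ i j : Fin n, p = ((j : ℕ) + 1, n + ((i : ℕ) + 1)) → G.Adj i j}

/-- Non-attacking placements of rooks on the squares of `B`. -/
def IsRookPlacement (B P : Set (ℕ × ℕ)) : Prop :=
  P ⊆ B ∧ ∀ p ∈ P, ∀ q ∈ P, p ≠ q → p.1 ≠ q.1 ∧ p.2 ≠ q.2

/-- Valid rook placements: maximal rook placements for which every row below the rook in column 1
contains a rook. -/
def validPlacements {n : ℕ} (G : SimpleGraph (Fin n)) : Set (Set (ℕ × ℕ)) :=
  {P | Maximal (IsRookPlacement (boardHatOf G)) P ∧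
    ∀ h, (1, h) ∈ P → ∀ r, 1 ≤ r → r < h → ∃ c, (c, r) ∈ P}


/-- The rook placement of an Ish region: the rook in column `i` is in the row of the position of
the letter `i` in `π` if there are no dots on `i`, and in row `n + d` if there are `d > 0` dots
on `i`. -/
noncomputable def rhoHat {n : ℕ} [NeZero n] (G : SimpleGraph (Fin n)) (R : Set (Fin n → ℝ)) :
    Set (ℕ × ℕ) :=
  {p | ∃ i : Fin n, p = ((i : ℕ) + 1,
    if ishDots G R ((regionPerm R).symm i) = 0 then (((regionPerm R).symm i : Fin n) : ℕ) + 1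
    else n + ishDots G R ((regionPerm R).symm i))}

/-- `LaserEnd n P j r`: the rook of `P` in column `j` is above the bar and the laser that it fires
downwards ends in row `r`. -/
inductive LaserEnd (n : ℕ) (P : Set (ℕ × ℕ)) : ℕ → ℕ → Prop
  | ofBelow (j i r : ℕ) : 1 ≤ i → (j, n + i) ∈ P → (i, r) ∈ P → r ≤ n → LaserEnd n P j r
  | ofAbove (j i k r : ℕ) : 1 ≤ i → (j, n + i) ∈ P → (i, k) ∈ P → n < k → LaserEnd n P i r →
      LaserEnd n P j r

/-- The vertical laser map `λ`: `w_i` is the number of squares in column `i` of the board that are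
weakly below the rook in that column and weakly below the endpoint of its laser (if it fires). -/
noncomputable def laserWord {n : ℕ} (P : Set (ℕ × ℕ)) : Fin n → ℕ :=
  fun i => Set.ncard {r : ℕ | ((i : ℕ) + 1, r) ∈ boardHat n ∧
    (∃ h, ((i : ℕ) + 1, h) ∈ P ∧ r ≤ h) ∧ ∀ e, LaserEnd n P ((i : ℕ) + 1) e → r ≤ e}

end IshRooks

/-- The composition `ω ∘ β ∘ λ ∘ ρ̂` from regions of `Ish(G)` to regions of `Shi(G)`. -/
noncomputable def ishToShi {n : ℕ} [NeZero n] (G : SimpleGraph (Fin n)) :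
    Set (Fin n → ℝ) → Set (Fin n → ℝ) :=
  omega G ∘ beta ∘ laserWord ∘ rhoHat G

end ShiIsh

namespace ShiIsh

open Set

/-! Each region is encoded by its permutation and its ceilings. A region is a sign cell, and a
hyperplane is a ceiling when its inequality is irredundant: one can cross it alone
(`isCeiling_of_flip`), whereas a redundant inequality would force an extra equality of coordinates
on the facet (`IsCeiling.exists_ne`). For Shi(G), irredundance says that the positions of the edge
`i < j` bound a maximal interval among the edges with difference below 1. For Ish(G), it says that
no other edge gives a bound at most as high at a coordinate at most as large. In both cases the
pairs `i < j` of ceilings are exactly the arcs of a set partition, and together with the permutation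
they determine the region.

The permutation is recovered from the arcs and the positions of the block minima alone. In a Shi
diagram the right ends of arcs occur in the order of the positions of the left ends
(`ArcRel.nonnesting_unique`); in an Ish diagram they occur in the order of the left ends as numbers
(`ArcRel.increasing_unique`). Thus each region amounts to a word that is constant on blocks and
whose letter on a block is the position of its minimum. On the Shi side these words are the parking
functions, the diagram being rebuilt by a queue (`exists_nonnesting`). On the Ish side the only
constraint is that all positions before the letter 1 are held by block minima; this is validity of a
placement and, once each laser has carried the row of the block minimum along the block, the rook
word condition.

Every cyclic orbit of words contains exactly one parking function (`existsUnique_park`) and one rook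
word (`exists_rook`, `rook_unique`). Shifting letters preserves their equality pattern, so β, and
with it the whole composition, preserves the ceiling partition. In the dominant case the word gives
each block minimum its own number; it is then both a rook word and a parking function, hence fixed
by β, and for the identity permutation the two ordering rules coincide. -/

variable {n : ℕ}

/-! ### Regions as sign cells; facets and ceilings. -/

/-- The affine function defining the hyperplane `x_i - x_j = c`. -/
def ev (t : Fin n × Fin n × ℝ) (x : Fin n → ℝ) : ℝ := x t.1 - x t.2.1 - t.2.2

/-- The arrangement of the hyperplanes indexed by `T`. -/
def arr (T : Set (Fin n × Fin n × ℝ)) : Set (Set (Fin n → ℝ)) :=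
  {H | ∃ t ∈ T, H = hyper t.1 t.2.1 t.2.2}

/-- The points on the same side as `x` of all hyperplanes indexed by `T`. -/
def cell (T : Set (Fin n × Fin n × ℝ)) (x : Fin n → ℝ) : Set (Fin n → ℝ) :=
  {y | ∀ t ∈ T, 0 < ev t x * ev t y}

/-- The points avoiding all hyperplanes indexed by `T`. -/
def Generic (T : Set (Fin n × Fin n × ℝ)) (x : Fin n → ℝ) : Prop := ∀ t ∈ T, ev t x ≠ 0

theorem continuous_ev (t : Fin n × Fin n × ℝ) : Continuous (ev t) := by
  unfold ev; fun_prop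

theorem ev_combo (t : Fin n × Fin n × ℝ) (x y : Fin n → ℝ) {a b : ℝ} (h : a + b = 1) :
    ev t (a • x + b • y) = a * ev t x + b * ev t y := by
  simp only [ev, Pi.add_apply, Pi.smul_apply, smul_eq_mul]
  linear_combination t.2.2 * h

theorem mem_hyper_iff_ev {t : Fin n × Fin n × ℝ} {x : Fin n → ℝ} :
    x ∈ hyper t.1 t.2.1 t.2.2 ↔ ev t x = 0 := by
  simp [hyper, ev, sub_eq_zero]

theorem compl_arr (T : Set (Fin n × Fin n × ℝ)) : (⋃₀ arr T)ᶜ = {x | Generic T x} := by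
  ext x
  simp only [mem_compl_iff, mem_sUnion, arr, mem_ofPred_eq, Generic, not_exists, not_and]
  constructor
  · intro h t ht h0
    exact h _ ⟨t, ht, rfl⟩ (mem_hyper_iff_ev.2 h0)
  · rintro h _ ⟨t, ht, rfl⟩ hx
    exact h t ht (mem_hyper_iff_ev.1 hx)

theorem mem_cell_self {T : Set (Fin n × Fin n × ℝ)} {x : Fin n → ℝ} (hx : Generic T x) :
    x ∈ cell T x := fun t ht => mul_self_pos.2 (hx t ht)

theorem Generic.of_mem_cell {T : Set (Fin n × Fin n × ℝ)} {x y : Fin n → ℝ}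
    (hy : y ∈ cell T x) : Generic T y := fun t ht h => by
  have := hy t ht
  simp [h] at this

theorem convex_cell (T : Set (Fin n × Fin n × ℝ)) (x : Fin n → ℝ) : Convex ℝ (cell T x) := by
  intro y hy z hz a b ha hb hab t ht
  rw [ev_combo t y z hab]
  have h1 := hy t ht
  have h2 := hz t ht
  rcases ha.eq_or_lt with rfl | ha
  · have : b = 1 := by linarith
    subst this; simpa using h2
  · have := mul_pos ha h1
    have := mul_nonneg hb h2.le
    nlinarith

/-- By the intermediate value theorem a connected set avoiding the hyperplanes cannot change the
sign of any `ev t`; conversely a cell is convex, hence connected. -/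
theorem connectedComponentIn_arr {T : Set (Fin n × Fin n × ℝ)} {x : Fin n → ℝ}
    (hx : Generic T x) : connectedComponentIn (⋃₀ arr T)ᶜ x = cell T x := by
  rw [compl_arr]
  apply Subset.antisymm
  · intro y hy t ht
    have hsub := connectedComponentIn_subset {x | Generic T x} x
    by_contra hcon
    have hpre := (isPreconnected_connectedComponentIn (x := x) (F := {x | Generic T x})).image
      (ev t) (continuous_ev t).continuousOn
    have hxm : x ∈ connectedComponentIn {x | Generic T x} x := mem_connectedComponentIn hx
    have hord := hpre.ordConnected
    have h1 := mem_image_of_mem (ev t) hxm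
    have h2 := mem_image_of_mem (ev t) hy
    have h0 : (0 : ℝ) ∈ ev t '' connectedComponentIn {x | Generic T x} x := by
      rcases lt_or_ge (ev t x) 0 with h | h
      · exact hord.out h1 h2 ⟨h.le, by nlinarith⟩
      · have h' : 0 < ev t x := lt_of_le_of_ne h (Ne.symm (hx t ht))
        exact hord.out h2 h1 ⟨by nlinarith, h⟩
    obtain ⟨z, hz, hz0⟩ := h0
    exact hsub hz t ht hz0
  · exact (convex_cell T x).isPreconnected.subset_connectedComponentIn (mem_cell_self hx)
      fun y hy => Generic.of_mem_cell hy

theorem regions_arr (T : Set (Fin n × Fin n × ℝ)) :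
    regions (arr T) = {R | ∃ x, Generic T x ∧ R = cell T x} := by
  ext R
  simp only [regions, mem_ofPred_eq]
  constructor
  · rintro ⟨x, hx, rfl⟩
    rw [compl_arr] at hx
    exact ⟨x, hx, connectedComponentIn_arr hx⟩
  · rintro ⟨x, hx, rfl⟩
    exact ⟨x, by rw [compl_arr]; exact hx, (connectedComponentIn_arr hx).symm⟩

theorem cell_eq_of_mem {T : Set (Fin n × Fin n × ℝ)} {x y : Fin n → ℝ} (hy : y ∈ cell T x) :
    cell T y = cell T x := by
  ext z
  refine forall₂_congr fun t ht => ?_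
  have := hy t ht
  constructor <;> intro h
  · by_contra hc
    push Not at hc
    have h1 := mul_pos this h
    have h2 : 0 ≤ ev t y ^ 2 := sq_nonneg _
    nlinarith
  · by_contra hc
    push Not at hc
    have h1 := mul_pos this h
    have h2 : 0 ≤ ev t x ^ 2 := sq_nonneg _
    nlinarith

theorem mem_cell_iff {T : Set (Fin n × Fin n × ℝ)} {x y : Fin n → ℝ} (hx : Generic T x)
    (hy : Generic T y) : y ∈ cell T x ↔ ∀ t ∈ T, (ev t x < 0 ↔ ev t y < 0) := by
  refine forall₂_congr fun t ht => ?_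
  rcases lt_or_gt_of_ne (hx t ht) with h1 | h1 <;> rcases lt_or_gt_of_ne (hy t ht) with h2 | h2
  · simp [h1, h2, mul_pos_of_neg_of_neg]
  · simp [h1, h2.not_gt, (mul_neg_of_neg_of_pos h1 h2).not_gt]
  · simp [h2, h1.not_gt, (mul_neg_of_pos_of_neg h1 h2).not_gt]
  · simp [h1.not_gt, h2.not_gt, mul_pos h1 h2]

theorem closure_cell_subset (T : Set (Fin n × Fin n × ℝ)) (x : Fin n → ℝ) :
    closure (cell T x) ⊆ {z | ∀ t ∈ T, 0 ≤ ev t x * ev t z} := by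
  apply closure_minimal
  · exact fun y hy t ht => (hy t ht).le
  · simp only [ofPred_forall]
    exact isClosed_iInter fun t => isClosed_iInter fun _ =>
      isClosed_le continuous_const (continuous_const.mul (continuous_ev t))

/-- The hyperplane as an affine subspace. -/
def hyperSub (i j : Fin n) (c : ℝ) : AffineSubspace ℝ (Fin n → ℝ) where
  carrier := hyper i j c
  smul_vsub_vadd_mem' := by
    intro a p q r hp hq hr
    simp only [hyper, mem_ofPred_eq, vsub_eq_sub, vadd_eq_add, Pi.add_apply, Pi.smul_apply,
      Pi.sub_apply, smul_eq_mul] at *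
    linear_combination a * hp - a * hq + hr

theorem coe_hyperSub (i j : Fin n) (c : ℝ) :
    (hyperSub i j c : Set (Fin n → ℝ)) = hyper i j c := rfl

/-- If one of `k`, `l` lies outside `{i, j}`, its coordinate is free; otherwise the two coordinates
differ by `c` up to sign. -/
theorem exists_mem_hyper {i j k l : Fin n} {c : ℝ} (hij : i ≠ j) (hkl : k ≠ l) (hc : c ≠ 0) :
    ∃ z ∈ hyper i j c, z k ≠ z l := by
  by_cases h : ∃ m, (m = k ∨ m = l) ∧ m ≠ i ∧ m ≠ j
  · obtain ⟨m, hm, hi, hj⟩ := h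
    obtain ⟨o, ho, hmo⟩ : ∃ o, o ≠ m ∧ (m = k ∧ o = l ∨ m = l ∧ o = k) := by
      rcases hm with rfl | rfl
      · exact ⟨l, hkl.symm, Or.inl ⟨rfl, rfl⟩⟩
      · exact ⟨k, hkl, Or.inr ⟨rfl, rfl⟩⟩
    -- The value `|c| + 1` exceeds both other values, `c` and `0`.
    let z : Fin n → ℝ := fun a => if a = i then c else if a = m then |c| + 1 else 0
    have hz : z m ≠ z o := by
      have h1 : z m = |c| + 1 := by simp [z, hi]
      have h2 : z o ≤ |c| := by
        simp only [z, ho, if_false]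
        split_ifs
        · exact le_abs_self c
        · exact abs_nonneg c
      intro h; linarith
    refine ⟨z, ?_, ?_⟩
    · simp [z, hyper, hij.symm, hj.symm]
    · rcases hmo with ⟨rfl, rfl⟩ | ⟨rfl, rfl⟩
      · exact hz
      · exact hz.symm
  · push Not at h
    refine ⟨fun a => if a = i then c else 0, by simp [hyper, hij.symm], ?_⟩
    by_cases hk : k = i
    · subst hk
      simpa [hkl.symm] using hc
    · have := h k (Or.inl rfl) hk
      subst this
      have hl : l = i := by
        by_contra hl
        exact hkl (h l (Or.inr rfl) hl).symm
      subst hl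
      simpa [hkl] using hc.symm

theorem finrank_direction_hyperSub {i j : Fin n} (hij : i ≠ j) (c : ℝ) :
    Module.finrank ℝ (hyperSub i j c).direction + 1 = n := by
  let f : (Fin n → ℝ) →ₗ[ℝ] ℝ :=
    (LinearMap.proj i : (Fin n → ℝ) →ₗ[ℝ] ℝ) - (LinearMap.proj j : (Fin n → ℝ) →ₗ[ℝ] ℝ)
  have hf : f ≠ 0 := by
    intro h
    have := congrArg (fun g => g (Pi.single i 1)) h
    simp [f, hij.symm] at this
  have hd : (hyperSub i j c).direction = LinearMap.ker f := by
    have hne : (fun a => if a = i then c else 0) ∈ hyperSub i j c := by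
      change _ ∈ hyper i j c
      simp [hyper, hij.symm]
    ext v
    rw [AffineSubspace.mem_direction_iff_eq_vsub_right hne]
    constructor
    · rintro ⟨p, hp, rfl⟩
      change p ∈ hyper i j c at hp
      simp only [hyper, mem_ofPred_eq] at hp
      simp [f, hij.symm]
      linarith
    · intro hv
      refine ⟨v + fun a => if a = i then c else 0, ?_, by simp⟩
      change _ ∈ hyper i j c
      simp [f, sub_eq_zero] at hv
      simp [hyper, hij.symm, hv]
  rw [hd]
  have h1 := LinearMap.finrank_range_add_finrank_ker f
  have h2 : LinearMap.range f = ⊤ := LinearMap.range_eq_top.2 (LinearMap.surjective hf)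
  rw [h2] at h1
  simp at h1
  omega

/-- The facet spans its hyperplane, which is contained in no hyperplane `x_k = x_l`. Hence any
argument forcing an extra equality of coordinates on the facet shows that there is no ceiling. -/
theorem IsCeiling.exists_ne {A : Set (Set (Fin n → ℝ))} {R : Set (Fin n → ℝ)} {i j k l : Fin n}
    {c : ℝ} (h : IsCeiling A R (hyper i j c)) (hij : i ≠ j) (hkl : k ≠ l) (hc : c ≠ 0) :
    ∃ z ∈ closure R, z i - z j = c ∧ z k ≠ z l := by
  obtain ⟨-, -, ⟨F, ⟨⟨-, S, -, hF⟩, -⟩, hspan⟩, -⟩ := h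
  by_contra hcon
  push Not at hcon
  have hFH : F ⊆ hyper i j c := hspan ▸ subset_affineSpan ℝ F
  have hsub : F ⊆ (hyperSub k l 0 : Set (Fin n → ℝ)) := by
    intro z hz
    have := hcon z (hF ▸ hz).1 (hFH hz)
    simp [coe_hyperSub, hyper, this]
  have h2 : hyper i j c ⊆ hyper k l 0 := by
    rw [← hspan]
    exact affineSpan_le.2 hsub
  obtain ⟨z, hz, hne⟩ := exists_mem_hyper hij hkl hc
  exact hne (sub_eq_zero.1 (h2 hz))

theorem IsCeiling.lt_of_cell {T : Set (Fin n × Fin n × ℝ)} {x : Fin n → ℝ} {i j : Fin n} {c : ℝ}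
    (hc : 0 < c) (ht : (i, j, c) ∈ T) (h : IsCeiling (arr T) (cell T x) (hyper i j c)) :
    x i - x j < c := by
  obtain ⟨-, -, -, hsep⟩ := h
  simp only [Separates, not_forall] at hsep
  obtain ⟨y, hy, hys⟩ := hsep
  have h1 := hy _ ht
  simp only [ev] at h1
  have : y i - y j < c := by
    by_contra hge
    push Not at hge
    apply hys
    have hpos : 0 < y i - y j := hc.trans_le hge
    -- The ray from the origin through `y` meets the hyperplane at this point, which lies between
    -- the origin and `y`.
    refine ⟨(c / (y i - y j)) • y, ⟨c / (y i - y j), 1 - c / (y i - y j), by positivity, ?_,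
      by ring, by simp⟩, ?_⟩
    · rw [sub_nonneg, div_le_one hpos]; exact hge
    · simp only [hyper, mem_ofPred_eq, Pi.smul_apply, smul_eq_mul]
      field_simp
  nlinarith

/-- The segment from `x` to `x'` crosses this hyperplane and no other one. Near the crossing point
the hyperplane lies in the closure of the cell, so this face spans it. -/
theorem isCeiling_of_flip {T : Set (Fin n × Fin n × ℝ)} (hT : T.Finite) {x x' : Fin n → ℝ}
    {i j : Fin n} {c : ℝ} (hij : i ≠ j) (hc : 0 < c) (ht : (i, j, c) ∈ T) (hx : Generic T x)
    (h1 : x i - x j < c) (h2 : c < x' i - x' j)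
    (h : ∀ t ∈ T, t ≠ (i, j, c) → 0 < ev t x * ev t x') :
    IsCeiling (arr T) (cell T x) (hyper i j c) := by
  set t₀ : Fin n × Fin n × ℝ := (i, j, c) with ht₀
  have e1 : ev t₀ x < 0 := by simp only [ev, ht₀]; linarith
  have e2 : 0 < ev t₀ x' := by simp only [ev, ht₀]; linarith
  have hcombo : ∀ t, ∀ y y' : Fin n → ℝ, ∀ s : ℝ, 0 < s → s ≤ 1 → 0 < ev t x * ev t y →
      0 ≤ ev t x * ev t y' → 0 < ev t x * ev t (s • y + (1 - s) • y') := by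
    intro t y y' s hs hs1 hy hy'
    rw [ev_combo t y y' (by ring)]
    have := mul_pos hs hy
    have := mul_nonneg (sub_nonneg.2 hs1) hy'
    nlinarith
  obtain ⟨z, hz0, hz⟩ : ∃ z, ev t₀ z = 0 ∧ ∀ t ∈ T, t ≠ t₀ → 0 < ev t x * ev t z := by
    have hd : 0 < ev t₀ x' - ev t₀ x := by linarith
    refine ⟨(ev t₀ x' / (ev t₀ x' - ev t₀ x)) • x + (1 - ev t₀ x' / (ev t₀ x' - ev t₀ x)) • x',
      ?_, ?_⟩
    · rw [ev_combo _ _ _ (by ring)]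
      field_simp
      ring
    · intro t htT hne
      refine hcombo t x x' _ (by positivity) ?_ (mul_self_pos.2 (hx t htT)) (h t htT hne).le
      rw [div_le_one hd]; linarith
  set O : Set (Fin n → ℝ) := {w | ∀ t ∈ T, t ≠ t₀ → 0 < ev t x * ev t w} with hO
  have hOopen : IsOpen O := by
    have : O = ⋂ t ∈ T, {w | t ≠ t₀ → 0 < ev t x * ev t w} := by ext w; simp [hO]
    rw [this]
    refine hT.isOpen_biInter fun t _ => ?_
    by_cases hne : t = t₀
    · simp [hne]
    · simpa [hne] using isOpen_lt continuous_const (continuous_const.mul (continuous_ev t))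
  have hOF : ∀ w ∈ O, ev t₀ w = 0 → w ∈ closure (cell T x) := by
    intro w hw hw0
    have hlim : Filter.Tendsto (fun s : ℝ => s • x + (1 - s) • w) (nhdsWithin 0 (Ioi 0))
        (nhds w) := by
      have : Continuous (fun s : ℝ => s • x + (1 - s) • w) := by fun_prop
      have h0 := this.tendsto 0
      simp only [zero_smul, sub_zero, one_smul, zero_add] at h0
      exact h0.mono_left nhdsWithin_le_nhds
    refine mem_closure_of_tendsto hlim ?_
    filter_upwards [Ioo_mem_nhdsGT (zero_lt_one (α := ℝ))] with s hs t htT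
    refine hcombo t x w s hs.1 hs.2.le (mul_self_pos.2 (hx t htT)) ?_
    by_cases hne : t = t₀
    · rw [hne, hw0, mul_zero]
    · exact (hw t htT hne).le
  set F := closure (cell T x) ∩ hyper i j c with hF
  have hzF : z ∈ F := ⟨hOF z hz hz0, mem_hyper_iff_ev.2 hz0⟩
  have hspan : affineSpan ℝ F = hyperSub i j c := by
    apply le_antisymm
    · exact affineSpan_le.2 fun w hw => hw.2
    · intro v hv
      have hv0 : ev t₀ v = 0 := mem_hyper_iff_ev.1 hv
      have hlim : Filter.Tendsto (fun s : ℝ => AffineMap.lineMap z v s) (nhdsWithin 0 (Ioi 0))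
          (nhds z) := by
        have : Continuous (fun s : ℝ => (AffineMap.lineMap z v s : Fin n → ℝ)) :=
          AffineMap.lineMap_continuous
        have h0 := this.tendsto 0
        rw [AffineMap.lineMap_apply_zero] at h0
        exact h0.mono_left nhdsWithin_le_nhds
      obtain ⟨s, hsO, hs⟩ := ((hlim.eventually (hOopen.mem_nhds hz)).and
        (self_mem_nhdsWithin)).exists
      have hs : 0 < s := hs
      have hev : ev t₀ (AffineMap.lineMap z v s) = 0 := by
        rw [AffineMap.lineMap_apply_module, ev_combo _ _ _ (by ring), hz0, hv0]; ring
      have hmem : AffineMap.lineMap z v s ∈ F := ⟨hOF _ hsO hev, mem_hyper_iff_ev.2 hev⟩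
      -- Any point of the hyperplane is reached by stretching a nearby point of the face away from
      -- `z`.
      have : v = AffineMap.lineMap z (AffineMap.lineMap z v s : Fin n → ℝ) s⁻¹ := by
        ext a
        simp only [AffineMap.lineMap_apply_module, Pi.add_apply, Pi.smul_apply, smul_eq_mul]
        field_simp
        ring
      rw [this]
      exact AffineMap.lineMap_mem _ (subset_affineSpan ℝ F hzF) (subset_affineSpan ℝ F hmem)
  refine ⟨⟨t₀, ht, rfl⟩, ?_, ⟨F, ⟨⟨⟨z, hzF⟩, {hyper i j c}, ?_, by simp [hF]⟩, ?_⟩, ?_⟩, ?_⟩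
  · simp [hyper, hc.ne]
  · exact singleton_subset_iff.2 ⟨t₀, ht, rfl⟩
  · rw [← direction_affineSpan, hspan]
    exact finrank_direction_hyperSub hij c
  · rw [hspan]; rfl
  · intro hsep
    obtain ⟨w, hw, hwH⟩ := hsep x (mem_cell_self hx)
    obtain ⟨a, b, ha, hb, hab, rfl⟩ := hw
    simp only [hyper, mem_ofPred_eq, Pi.add_apply, Pi.smul_apply, smul_eq_mul, Pi.zero_apply,
      mul_zero, add_zero] at hwH
    have hx1 : a * (x i - x j) = c := by linarith
    have hpos : 0 < x i - x j := by
      by_contra hle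
      push Not at hle
      have := mul_nonpos_of_nonneg_of_nonpos ha hle
      linarith
    have := mul_nonneg hb hpos.le
    have : (a + b) * (x i - x j) = x i - x j := by rw [hab, one_mul]
    linarith

/-- Positivity of the constants excludes the other description `x_j - x_i = -c` of the same
hyperplane. -/
theorem hyper_injective {i j k l : Fin n} {c d : ℝ} (hij : i ≠ j) (hkl : k ≠ l) (hc : 0 < c)
    (hd : 0 < d) (h : hyper i j c = hyper k l d) : i = k ∧ j = l ∧ c = d := by
  have h1 : (fun a => if a = i then c else 0) ∈ hyper k l d := by
    rw [← h]; simp [hyper, hij.symm]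
  have h2 : (fun a => if a = j then -c else 0) ∈ hyper k l d := by
    rw [← h]; simp [hyper, hij]
  simp only [hyper, mem_ofPred_eq] at h1 h2
  have hk : k = i := by
    by_contra hk
    simp only [hk, if_false] at h1
    split_ifs at h1 <;> linarith
  have hl : l = j := by
    by_contra hl
    simp only [hl, if_false] at h2
    split_ifs at h2 <;> linarith
  subst hk hl
  simp [hkl.symm] at h1
  exact ⟨rfl, rfl, h1⟩

/-! ### The permutation of a region. -/

/-- Indices of the Coxeter hyperplanes. -/
def coxIdx (n : ℕ) : Set (Fin n × Fin n × ℝ) := {t | t.1 < t.2.1 ∧ t.2.2 = 0}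

theorem Generic.injective {T : Set (Fin n × Fin n × ℝ)} (hT : coxIdx n ⊆ T) {x : Fin n → ℝ}
    (hx : Generic T x) : Function.Injective x := by
  intro a b hab
  by_contra hne
  rcases lt_or_gt_of_ne hne with h | h
  · exact hx (a, b, 0) (hT ⟨h, rfl⟩) (by simp [ev, hab])
  · exact hx (b, a, 0) (hT ⟨h, rfl⟩) (by simp [ev, hab])

theorem lt_iff_of_mem_cell {T : Set (Fin n × Fin n × ℝ)} (hT : coxIdx n ⊆ T) {x y : Fin n → ℝ}
    (hy : y ∈ cell T x) (a b : Fin n) : y a < y b ↔ x a < x b := by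
  rcases lt_trichotomy a b with h | rfl | h
  · have := hy (a, b, 0) (hT ⟨h, rfl⟩)
    simp only [ev] at this
    constructor <;> intro h <;> nlinarith
  · simp
  · have := hy (b, a, 0) (hT ⟨h, rfl⟩)
    simp only [ev] at this
    constructor <;> intro h <;> nlinarith

theorem le_of_mem_closure_cell {T : Set (Fin n × Fin n × ℝ)} (hT : coxIdx n ⊆ T)
    {x y : Fin n → ℝ} (hy : y ∈ closure (cell T x)) {a b : Fin n} (h : x a < x b) :
    y a ≤ y b := by
  have hy := closure_cell_subset T x hy
  rcases lt_trichotomy a b with hab | rfl | hab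
  · have := hy (a, b, 0) (hT ⟨hab, rfl⟩)
    simp only [ev] at this
    nlinarith
  · rfl
  · have := hy (b, a, 0) (hT ⟨hab, rfl⟩)
    simp only [ev] at this
    nlinarith

theorem exists_strictAnti_comp {x : Fin n → ℝ} (hx : Function.Injective x) :
    ∃ p : Equiv.Perm (Fin n), StrictAnti (x ∘ p) := by
  refine ⟨Tuple.sort (fun i => - x i), ?_⟩
  have h := Tuple.monotone_sort (fun i => - x i)
  have h2 : StrictMono ((fun i => - x i) ∘ Tuple.sort (fun i => - x i)) :=
    h.strictMono_of_injective ((neg_injective.comp hx).comp (Equiv.injective _))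
  intro a b hab
  have := h2 hab
  simpa using this

theorem strictAnti_comp_unique {x : Fin n → ℝ} {p q : Equiv.Perm (Fin n)}
    (hp : StrictAnti (x ∘ p)) (hq : StrictAnti (x ∘ q)) : p = q := by
  have h : StrictMono (p.symm ∘ q) := by
    intro a b hab
    have := hq hab
    by_contra hcon
    push Not at hcon
    have := hp.antitone hcon
    simp at *
    linarith
  have : (p.symm ∘ q : Fin n → Fin n) = id := by
    exact Subsingleton.elim (α := Fin n ≃o Fin n)
      (StrictMono.orderIsoOfSurjective _ h ((Equiv.surjective _).comp (Equiv.surjective _)))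
      (OrderIso.refl _) |> fun e => by
        ext1 a
        exact congrArg (fun f : Fin n ≃o Fin n => f a) e
  ext1 a
  have := congrFun this a
  simp at this
  rw [Equiv.symm_apply_eq] at this
  exact this.symm

/-- `regionPerm` of the cell of `x` lists the letters by decreasing coordinate of `x`. -/
theorem regionPerm_cell_eq {T : Set (Fin n × Fin n × ℝ)} (hT : coxIdx n ⊆ T) {x : Fin n → ℝ}
    (hx : Generic T x) {p : Equiv.Perm (Fin n)} (hp : StrictAnti (x ∘ p)) :
    regionPerm (cell T x) = p := by
  have hex : ∃ p : Equiv.Perm (Fin n), ∀ y ∈ cell T x, StrictAnti (y ∘ p) :=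
    ⟨p, fun y hy a b hab => (lt_iff_of_mem_cell hT hy _ _).2 (hp hab)⟩
  exact strictAnti_comp_unique (Classical.epsilon_spec hex x (mem_cell_self hx)) hp

theorem regionPerm_strictAnti {T : Set (Fin n × Fin n × ℝ)} (hT : coxIdx n ⊆ T) {x : Fin n → ℝ}
    (hx : Generic T x) : StrictAnti (x ∘ regionPerm (cell T x)) := by
  obtain ⟨p, hp⟩ := exists_strictAnti_comp (hx.injective hT)
  rwa [regionPerm_cell_eq hT hx hp]

theorem regionPerm_symm_lt {T : Set (Fin n × Fin n × ℝ)} (hT : coxIdx n ⊆ T) {x : Fin n → ℝ}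
    (hx : Generic T x) (a b : Fin n) :
    (regionPerm (cell T x)).symm a < (regionPerm (cell T x)).symm b ↔ x b < x a := by
  have := (regionPerm_strictAnti hT hx).lt_iff_gt
    (a := (regionPerm (cell T x)).symm b) (b := (regionPerm (cell T x)).symm a)
  simpa using this.symm

theorem isDominant_cell_iff {T : Set (Fin n × Fin n × ℝ)} (hT : coxIdx n ⊆ T) {x : Fin n → ℝ}
    (hx : Generic T x) : IsDominant (cell T x) ↔ regionPerm (cell T x) = 1 := by
  constructor
  · intro h
    exact regionPerm_cell_eq hT hx (h x (mem_cell_self hx))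
  · intro h y hy a b hab
    have := regionPerm_strictAnti hT hx
    rw [h] at this
    exact (lt_iff_of_mem_cell hT hy _ _).2 (this hab)

/-! ### Set partitions through their arcs and block minima. -/

/-- A relation that relates each element to at most one larger element and is injective; such a
relation is the set of arcs of the set partition that it generates. -/
structure ArcRel (r : Fin n → Fin n → Prop) : Prop where
  lt : ∀ {i j}, r i j → i < j
  right : ∀ {i j k}, r i j → r i k → j = k
  left : ∀ {i j k}, r i k → r j k → i = j

theorem ArcRel.le_of_reflTransGen {r : Fin n → Fin n → Prop} (hr : ArcRel r) {i j : Fin n}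
    (h : Relation.ReflTransGen r i j) : i ≤ j := by
  induction h with
  | refl => exact le_rfl
  | tail _ h ih => exact ih.trans (hr.lt h).le

/-- Successors and predecessors are unique, so of two chains with a common end one contains the
other; each block is therefore a single chain. -/
theorem ArcRel.eqvGen_iff {r : Fin n → Fin n → Prop} (hr : ArcRel r) {i j : Fin n} :
    Relation.EqvGen r i j ↔ Relation.ReflTransGen r i j ∨ Relation.ReflTransGen r j i := by
  constructor
  · intro h
    induction h with
    | rel _ _ h => exact Or.inl (.single h)
    | refl => exact Or.inl .refl
    | symm _ _ _ ih => exact ih.symm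
    | trans a b c _ _ ih1 ih2 =>
      have swap : ∀ {u v}, Relation.ReflTransGen (Function.swap r) u v →
          Relation.ReflTransGen r v u := fun h => Relation.reflTransGen_swap.1 h
      have swap' : ∀ {u v}, Relation.ReflTransGen r v u →
          Relation.ReflTransGen (Function.swap r) u v := fun h => Relation.reflTransGen_swap.2 h
      rcases ih1 with h1 | h1 <;> rcases ih2 with h2 | h2
      · exact Or.inl (h1.trans h2)
      · have := Relation.ReflTransGen.total_of_right_unique (r := Function.swap r)
          (fun _ _ _ h h' => hr.left h h') (swap' h1) (swap' h2)
        exact this.symm.imp swap swap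
      · exact Relation.ReflTransGen.total_of_right_unique
          (fun _ _ _ h h' => hr.right h h') h1 h2
      · exact Or.inr (h2.trans h1)
  · have key : ∀ {u v}, Relation.ReflTransGen r u v → Relation.EqvGen r u v := by
      intro u v h
      induction h with
      | refl => exact .refl _
      | tail _ h ih => exact .trans _ _ _ ih (.rel _ _ h)
    rintro (h | h)
    · exact key h
    · exact .symm _ _ (key h)

theorem ArcRel.isArc_eqvGen {r : Fin n → Fin n → Prop} (hr : ArcRel r) {i j : Fin n} :
    IsArc (Relation.EqvGen.setoid r) i j ↔ r i j := by
  constructor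
  · rintro ⟨hij, h, hk⟩
    rcases hr.eqvGen_iff.1 h with h | h
    · rcases h.cases_head with rfl | ⟨k, hik, hkj⟩
      · exact absurd hij (lt_irrefl _)
      · rcases (hr.le_of_reflTransGen hkj).eq_or_lt with rfl | hlt
        · exact hik
        · exact absurd (.rel _ _ hik) (hk k (hr.lt hik) hlt)
    · exact absurd hij (hr.le_of_reflTransGen h).not_gt
  · intro h
    refine ⟨hr.lt h, .rel _ _ h, fun k hik hkj hcon => ?_⟩
    rcases hr.eqvGen_iff.1 hcon with h' | h'
    · rcases h'.cases_head with rfl | ⟨l, hil, hlk⟩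
      · exact lt_irrefl _ hik
      · rw [hr.right hil h] at hlk
        exact (hr.le_of_reflTransGen hlk).not_gt hkj
    · exact (hr.le_of_reflTransGen h').not_gt hik

theorem arcRel_isArc (P : Setoid (Fin n)) : ArcRel (IsArc P) where
  lt h := h.1
  right := by
    rintro i j k ⟨h1, h2, h3⟩ ⟨h4, h5, h6⟩
    rcases lt_trichotomy j k with h | h | h
    · exact absurd h2 (h6 j h1 h)
    · exact h
    · exact absurd h5 (h3 k h4 h)
  left := by
    rintro i j k ⟨h1, h2, h3⟩ ⟨h4, h5, h6⟩
    rcases lt_trichotomy i j with h | h | h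
    · exact absurd (P.trans h2 (P.symm h5)) (h3 j h h4)
    · exact h
    · exact absurd (P.trans h5 (P.symm h2)) (h6 i h h1)

/-- A pair in a block is split at intermediate elements of the block until only consecutive pairs
remain. -/
theorem eqvGen_isArc (P : Setoid (Fin n)) : Relation.EqvGen.setoid (IsArc P) = P := by
  have key : ∀ d : ℕ, ∀ i j : Fin n, (j : ℕ) - i = d → i < j → P i j →
      Relation.EqvGen (IsArc P) i j := by
    intro d
    induction d using Nat.strong_induction_on with
    | _ d ih =>
      intro i j hd hij hP
      by_cases h : ∃ k, i < k ∧ k < j ∧ P i k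
      · obtain ⟨k, hik, hkj, hk⟩ := h
        have h1 : (i : ℕ) < k := hik
        have h2 : (k : ℕ) < j := hkj
        exact .trans _ _ _ (ih _ (by omega) i k rfl hik hk)
          (ih _ (by omega) k j rfl hkj (P.trans (P.symm hk) hP))
      · push Not at h
        exact .rel _ _ ⟨hij, hP, h⟩
  ext i j
  constructor
  · intro h
    induction (h : Relation.EqvGen (IsArc P) i j) with
    | rel _ _ h => exact h.2.1
    | refl => exact P.refl _
    | symm _ _ _ ih => exact P.symm ih
    | trans _ _ _ _ _ ih1 ih2 => exact P.trans ih1 ih2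
  · intro h
    rcases lt_trichotomy i j with hij | rfl | hij
    · exact key _ i j rfl hij h
    · exact .refl _
    · exact .symm _ _ (key _ j i rfl hij (P.symm h))

/-- The elements that have no predecessor, that is, the minimal elements of the blocks. -/
def IsRoot (r : Fin n → Fin n → Prop) (j : Fin n) : Prop := ∀ i, ¬ r i j

theorem ArcRel.exists_root {r : Fin n → Fin n → Prop} (hr : ArcRel r) (j : Fin n) :
    ∃ i, IsRoot r i ∧ Relation.ReflTransGen r i j := by
  induction j using WellFoundedLT.induction with
  | _ j ih =>
    by_cases h : IsRoot r j
    · exact ⟨j, h, .refl⟩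
    · simp only [IsRoot, not_forall, not_not] at h
      obtain ⟨k, hk⟩ := h
      obtain ⟨i, hi, hik⟩ := ih k (hr.lt hk)
      exact ⟨i, hi, hik.tail hk⟩

theorem eq_of_reflTransGen {α : Type*} {r : Fin n → Fin n → Prop} {w : Fin n → α}
    (hw : ∀ i j, r i j → w i = w j) {i j : Fin n} (h : Relation.ReflTransGen r i j) :
    w i = w j := by
  induction h with
  | refl => rfl
  | tail _ h ih => exact ih.trans (hw _ _ h)

theorem ArcRel.word_ext {α : Type*} {r : Fin n → Fin n → Prop} (hr : ArcRel r)
    {v w : Fin n → α}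
    (hv : ∀ i j, r i j → v i = v j) (hw : ∀ i j, r i j → w i = w j)
    (h : ∀ i, IsRoot r i → v i = w i) : v = w := by
  ext1 j
  obtain ⟨i, hi, hij⟩ := hr.exists_root j
  rw [← eq_of_reflTransGen hv hij, ← eq_of_reflTransGen hw hij, h i hi]

/-- Every letter is inherited from a block minimum, so distinct letters on the minima leave no
coincidence between different blocks. -/
theorem ArcRel.ker_eq {α : Type*} {r : Fin n → Fin n → Prop} (hr : ArcRel r) {w : Fin n → α}
    (hw : ∀ i j, r i j → w i = w j)
    (h : ∀ i j, IsRoot r i → IsRoot r j → w i = w j → i = j) :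
    Setoid.ker w = Relation.EqvGen.setoid r := by
  ext i j
  constructor
  · intro hij
    obtain ⟨a, ha, hai⟩ := hr.exists_root i
    obtain ⟨b, hb, hbj⟩ := hr.exists_root j
    have hab : a = b := h a b ha hb (by
      rw [eq_of_reflTransGen hw hai, eq_of_reflTransGen hw hbj]; exact hij)
    subst hab
    exact .trans _ _ _ (.symm _ _ (hr.eqvGen_iff.2 (Or.inl hai))) (hr.eqvGen_iff.2 (Or.inl hbj))
  · intro hij
    rcases hr.eqvGen_iff.1 hij with h | h
    · exact eq_of_reflTransGen hw h
    · exact (eq_of_reflTransGen hw h).symm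

theorem isArc_ker_eq {α : Type*} {w : Fin n → α} {i j : Fin n} (h : IsArc (Setoid.ker w) i j) :
    w i = w j := h.2.1

theorem isRoot_ker_unique {α : Type*} {w : Fin n → α} {i j : Fin n}
    (hi : IsRoot (IsArc (Setoid.ker w)) i) (hj : IsRoot (IsArc (Setoid.ker w)) j)
    (h : w i = w j) : i = j := by
  have hr := arcRel_isArc (Setoid.ker w)
  have h' : Relation.EqvGen (IsArc (Setoid.ker w)) i j := by
    have : Relation.EqvGen.setoid (IsArc (Setoid.ker w)) i j := by
      rw [eqvGen_isArc]; exact h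
    exact this
  rcases hr.eqvGen_iff.1 h' with h | h
  · rcases h.cases_tail with h | ⟨c, -, h⟩
    · exact h.symm
    · exact absurd h (hj c)
  · rcases h.cases_tail with h | ⟨c, -, h⟩
    · exact h
    · exact absurd h (hi c)

/-! ### Permutations determined by arcs and positions of block minima. -/

theorem perm_eq_of_step {P Q : Equiv.Perm (Fin n)}
    (h : ∀ i j, P i = Q j → (∀ k, P k < P i → Q k = P k) → (∀ k, Q k < P i → P k = Q k) →
      i = j) : P = Q := by
  -- Induction on the position: at the first position still open, both permutations agree on
  -- everything placed before.
  have key : ∀ p : Fin n, P.symm p = Q.symm p := by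
    intro p
    induction p using WellFoundedLT.induction with
    | _ p ih =>
      refine h _ _ (by simp) ?_ ?_
      · intro k hk
        rw [P.apply_symm_apply] at hk
        have := ih _ hk
        rw [P.symm_apply_apply, Equiv.eq_symm_apply] at this
        exact this
      · intro k hk
        rw [P.apply_symm_apply] at hk
        have := ih _ hk
        rw [Q.symm_apply_apply, Equiv.symm_apply_eq] at this
        exact this.symm
  have : P.symm = Q.symm := Equiv.ext key
  simpa using congrArg Equiv.symm this

/-- Nonnesting diagrams are determined by their arcs and the positions of the block minima. -/
theorem ArcRel.nonnesting_unique {r : Fin n → Fin n → Prop} (hr : ArcRel r)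
    {P Q : Equiv.Perm (Fin n)} (hroot : ∀ i, IsRoot r i → P i = Q i)
    (hP1 : ∀ i j, r i j → P i < P j) (hQ1 : ∀ i j, r i j → Q i < Q j)
    (hP : ∀ i j i' j', r i j → r i' j' → P i < P i' → P j < P j')
    (hQ : ∀ i j i' j', r i j → r i' j' → Q i < Q i' → Q j < Q j') : P = Q := by
  refine perm_eq_of_step fun i j hij h1 h2 => ?_
  by_cases hi : IsRoot r i
  · exact Q.injective ((hroot i hi).symm.trans hij)
  by_cases hj : IsRoot r j
  · exact P.injective (hij.trans (hroot j hj).symm)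
  simp only [IsRoot, not_forall, not_not] at hi hj
  obtain ⟨a, ha⟩ := hi
  obtain ⟨b, hb⟩ := hj
  -- The predecessors of `i` and `j` come before the disputed position, so `P` and `Q` agree on
  -- them. If `a` comes first, nonnesting for `Q` puts `i` before `j`, where both permutations
  -- agree, contradicting `P i = Q j`; the opposite case is symmetric.
  have ha1 := h1 a (hP1 _ _ ha)
  have hb1 := h2 b (hij ▸ hQ1 _ _ hb)
  rcases lt_trichotomy (P a) (P b) with h | h | h
  · have h3 := hQ _ _ _ _ ha hb (by rw [ha1, ← hb1]; exact h)
    have := h2 i (hij ▸ h3)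
    rw [← this, ← hij] at h3
    exact absurd h3 (lt_irrefl _)
  · have := P.injective h
    subst this
    exact hr.right ha hb
  · have h3 := hP _ _ _ _ hb ha h
    have := h1 j h3
    rw [← this, ← hij] at h3
    exact absurd h3 (lt_irrefl _)

/-- Diagrams in which the non-minimal elements of blocks are ordered as their predecessors are
determined by their arcs and the positions of the block minima. -/
theorem ArcRel.increasing_unique {r : Fin n → Fin n → Prop} (hr : ArcRel r)
    {P Q : Equiv.Perm (Fin n)} (hroot : ∀ i, IsRoot r i → P i = Q i)
    (hP : ∀ i j i' j', r i j → r i' j' → i < i' → P j < P j')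
    (hQ : ∀ i j i' j', r i j → r i' j' → i < i' → Q j < Q j') : P = Q := by
  refine perm_eq_of_step fun i j hij h1 h2 => ?_
  by_cases hi : IsRoot r i
  · exact Q.injective ((hroot i hi).symm.trans hij)
  by_cases hj : IsRoot r j
  · exact P.injective (hij.trans (hroot j hj).symm)
  simp only [IsRoot, not_forall, not_not] at hi hj
  obtain ⟨a, ha⟩ := hi
  obtain ⟨b, hb⟩ := hj
  -- The predecessors are compared as numbers, so nothing about their positions is needed.
  rcases lt_trichotomy a b with h | h | h
  · have h3 := hQ _ _ _ _ ha hb h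
    have := h2 i (hij ▸ h3)
    rw [← this, ← hij] at h3
    exact absurd h3 (lt_irrefl _)
  · subst h
    exact hr.right ha hb
  · have h3 := hP _ _ _ _ hb ha h
    have := h1 j h3
    rw [← this, ← hij] at h3
    exact absurd h3 (lt_irrefl _)

/-! ### Parking functions and the construction of diagrams. -/

theorem park_iff {w : Fin n → ℕ} : w ∈ Park n ↔ (∀ i, 1 ≤ w i ∧ w i ≤ n) ∧
    ∀ k ≤ n, k ≤ (Finset.univ.filter fun i => w i ≤ k).card := by
  refine and_congr_right fun hw => ⟨?_, ?_⟩
  · rintro ⟨s, -, hs⟩ k hk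
    let f : Fin k ↪ Fin n := (Fin.castLEEmb hk).trans s.toEmbedding
    calc k = (Finset.univ.map f).card := by simp
      _ ≤ _ := Finset.card_le_card fun i hi => by
        simp only [Finset.mem_map, Finset.mem_univ, true_and] at hi
        obtain ⟨a, rfl⟩ := hi
        have := hs (Fin.castLE hk a)
        simp only [Finset.mem_filter, Finset.mem_univ, true_and]
        refine this.trans ?_
        simp
  · intro h
    refine ⟨Tuple.sort w, Tuple.monotone_sort w, fun i => ?_⟩
    by_contra hcon
    push Not at hcon
    have h1 := h (i + 1) (by omega)
    -- If the sorted letter at index `i` exceeded `i + 1`, all letters up to `i + 1` would have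
    -- smaller sorted indices, of which there are only `i`.
    have h2 : (Finset.univ.filter fun j => w j ≤ i + 1) ⊆
        (Finset.Iio i).map (Tuple.sort w).toEmbedding := by
      intro j hj
      simp only [Finset.mem_filter, Finset.mem_univ, true_and] at hj
      simp only [Finset.mem_map, Finset.mem_Iio]
      refine ⟨(Tuple.sort w).symm j, ?_, by simp⟩
      by_contra hge
      push Not at hge
      have := Tuple.monotone_sort w hge
      simp at this
      omega
    have h3 := Finset.card_le_card h2
    simp at h3
    omega

/-- A stage of the queue that places the letters of a parking function: the positions below `p`
are filled according to `e`. -/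
structure QueueStage (w : Fin n → ℕ) (p : ℕ) (e : ℕ → Fin n) : Prop where
  inj : ∀ a < p, ∀ b < p, e a = e b → a = b
  root : ∀ i, IsRoot (IsArc (Setoid.ker w)) i → w i ≤ p → e (w i - 1) = i
  closed : ∀ q < p, ∀ j, IsArc (Setoid.ker w) j (e q) → ∃ a < q, e a = j
  fifo : ∀ q < p, ∀ a' < q, IsArc (Setoid.ker w) (e a') (e q) → ∀ a < a', ∀ i,
    IsArc (Setoid.ker w) (e a) i → ∃ b < q, e b = i
  le : ∀ q < p, w (e q) ≤ q + 1

theorem QueueStage.extend {w : Fin n → ℕ} (hw : ∀ i, 1 ≤ w i) {p : ℕ} {e : ℕ → Fin n}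
    (h : QueueStage w p e) {i : Fin n} (hi : ∀ a < p, e a ≠ i) (hle : w i ≤ p + 1)
    (hroot : ∀ k, IsRoot (IsArc (Setoid.ker w)) k → w k = p + 1 → k = i)
    (hclosed : ∀ j, IsArc (Setoid.ker w) j i → ∃ a < p, e a = j)
    (hfifo : ∀ a' < p, IsArc (Setoid.ker w) (e a') i → ∀ a < a', ∀ k,
      IsArc (Setoid.ker w) (e a) k → ∃ b < p, e b = k) :
    QueueStage w (p + 1) (Function.update e p i) := by
  have hlt : ∀ {a}, a < p → Function.update e p i a = e a := fun h =>
    Function.update_of_ne h.ne _ _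
  have hp : Function.update e p i p = i := Function.update_self ..
  constructor
  · intro a ha b hb hab
    rcases (Nat.lt_succ_iff.1 ha).lt_or_eq with ha | rfl <;>
      rcases (Nat.lt_succ_iff.1 hb).lt_or_eq with hb | rfl
    · rw [hlt ha, hlt hb] at hab
      exact h.inj a ha b hb hab
    · rw [hlt ha, hp] at hab
      exact absurd hab (hi a ha)
    · rw [hlt hb, hp] at hab
      exact absurd hab.symm (hi b hb)
    · rfl
  · intro k hk hkp
    have := hw k
    rcases Nat.le_or_eq_of_le_succ hkp with hk' | hk'
    · rw [hlt (by omega)]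
      exact h.root k hk hk'
    · rw [hk', Nat.succ_eq_add_one, Nat.add_sub_cancel, hp]
      exact (hroot k hk hk').symm
  · intro q hq j hj
    rcases (Nat.lt_succ_iff.1 hq).lt_or_eq with hq | rfl
    · rw [hlt hq] at hj
      obtain ⟨a, ha, he⟩ := h.closed q hq j hj
      exact ⟨a, ha, by rw [hlt (ha.trans hq), he]⟩
    · rw [hp] at hj
      obtain ⟨a, ha, he⟩ := hclosed j hj
      exact ⟨a, ha, by rw [hlt ha, he]⟩
  · intro q hq a' ha' hr a ha k hk
    rcases (Nat.lt_succ_iff.1 hq).lt_or_eq with hq | rfl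
    · rw [hlt hq, hlt (ha'.trans hq)] at hr
      rw [hlt (ha.trans (ha'.trans hq))] at hk
      obtain ⟨b, hb, he⟩ := h.fifo q hq a' ha' hr a ha k hk
      exact ⟨b, hb, by rw [hlt (hb.trans hq), he]⟩
    · rw [hp, hlt ha'] at hr
      rw [hlt (ha.trans ha')] at hk
      obtain ⟨b, hb, he⟩ := hfifo a' ha' hr a ha k hk
      exact ⟨b, hb, by rw [hlt hb, he]⟩
  · intro q hq
    rcases (Nat.lt_succ_iff.1 hq).lt_or_eq with hq | rfl
    · rw [hlt hq]
      exact h.le q hq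
    · rwa [hp]

/-- A block minimum whose letter names the next position takes it. Otherwise the position goes to
the waiting successor of the earliest placed element that has one; the parking condition ensures
that the queue is not empty. -/
theorem QueueStage.exists_succ {w : Fin n → ℕ} (hw : w ∈ Park n) {p : ℕ} (hpn : p < n)
    {e : ℕ → Fin n} (h : QueueStage w p e) : ∃ e', QueueStage w (p + 1) e' := by
  obtain ⟨hw1, hw2⟩ := park_iff.1 hw
  have hr := arcRel_isArc (Setoid.ker w)
  by_cases hex : ∃ i, IsRoot (IsArc (Setoid.ker w)) i ∧ w i = p + 1
  · obtain ⟨i, hi, hwi⟩ := hex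
    refine ⟨_, h.extend (fun i => (hw1 i).1) (i := i) ?_ hwi.le ?_ ?_ ?_⟩
    · rintro a ha rfl
      have := h.le a ha
      omega
    · intro k hk hwk
      exact isRoot_ker_unique hk hi (hwk.trans hwi.symm)
    · exact fun j hj => absurd hj (hi j)
    · exact fun a' _ hj => absurd hj (hi _)
  · push Not at hex
    have hne : ∃ a, a < p ∧ ∃ i, IsArc (Setoid.ker w) (e a) i ∧ ∀ b < p, e b ≠ i := by
      have hun : ∃ i, w i ≤ p + 1 ∧ ∀ b < p, e b ≠ i := by
        by_contra hcon
        push Not at hcon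
        -- Parking supplies at least `p + 1` elements with letter at most `p + 1`, while only `p`
        -- are placed.
        have h1 : (Finset.univ.filter fun i => w i ≤ p + 1) ⊆ (Finset.range p).image e := by
          intro i hi
          obtain ⟨b, hb, he⟩ := hcon i (by simpa using hi)
          exact Finset.mem_image.2 ⟨b, by simpa using hb, he⟩
        have h2 := (hw2 (p + 1) hpn).trans (Finset.card_le_card h1)
        have h3 := Finset.card_image_le (s := Finset.range p) (f := e)
        simp at h3
        omega
      -- The smallest unplaced element is not a block minimum, and its predecessor, which has the
      -- same letter, is already placed.
      have hmin : ∃ i, (w i ≤ p + 1 ∧ ∀ b < p, e b ≠ i) ∧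
          ∀ k < i, ¬ (w k ≤ p + 1 ∧ ∀ b < p, e b ≠ k) := by
        obtain ⟨i, hi, hm⟩ := WellFounded.has_min wellFounded_lt
          {i | w i ≤ p + 1 ∧ ∀ b < p, e b ≠ i} hun
        exact ⟨i, hi, fun k hk hc => hm k hc hk⟩
      obtain ⟨i, ⟨hi1, hi2⟩, hm⟩ := hmin
      have hroot : ¬ IsRoot (IsArc (Setoid.ker w)) i := by
        intro hroot
        have h1 := hex i hroot
        have h2 := h.root i hroot (by omega)
        exact hi2 _ (by have := (hw1 i).1; omega) h2
      simp only [IsRoot, not_forall, not_not] at hroot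
      obtain ⟨k, hk⟩ := hroot
      have := hm k hk.1
      push Not at this
      obtain ⟨a, ha, rfl⟩ := this ((isArc_ker_eq hk).trans_le hi1)
      exact ⟨a, ha, i, hk, hi2⟩
    classical
    obtain ⟨hap, i, hai, hi⟩ := Nat.find_spec hne
    have hmin := fun a (ha : a < Nat.find hne) => Nat.find_min hne ha
    set a := Nat.find hne
    refine ⟨_, h.extend (fun i => (hw1 i).1) (i := i) hi ?_ ?_ ?_ ?_⟩
    · rw [← isArc_ker_eq hai]
      exact (h.le a hap).trans (by omega)
    · exact fun k hk hwk => absurd hwk (hex k hk)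
    · exact fun j hj => ⟨a, hap, hr.left hai hj⟩
    · intro a' ha' hr' b hb k hk
      have : a' = a := h.inj _ ha' _ hap (hr.left hr' hai)
      subst this
      have := hmin b hb
      push Not at this
      exact this (hb.trans hap) k hk

/-- Every parking function labels a nonnesting diagram. -/
theorem exists_nonnesting {w : Fin n → ℕ} (hw : w ∈ Park n) : ∃ P : Equiv.Perm (Fin n),
    (∀ i, IsRoot (IsArc (Setoid.ker w)) i → (P i : ℕ) + 1 = w i) ∧
    (∀ i j, IsArc (Setoid.ker w) i j → P i < P j) ∧
    ∀ i j i' j', IsArc (Setoid.ker w) i j → IsArc (Setoid.ker w) i' j' → P i < P i' →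
      P j < P j' := by
  rcases Nat.eq_zero_or_pos n with rfl | hn
  · exact ⟨1, fun i => i.elim0, fun i => i.elim0, fun i => i.elim0⟩
  have hst : ∀ p ≤ n, ∃ e, QueueStage w p e := by
    intro p
    induction p with
    | zero =>
      intro _
      -- Only values below the current stage matter, so the initial map is arbitrary.
      exact ⟨fun _ => ⟨0, hn⟩, fun a ha => absurd ha (Nat.not_lt_zero a),
        fun i _ hi => absurd (hw.1 i).1 (by omega), fun a ha => absurd ha (Nat.not_lt_zero a),
        fun a ha => absurd ha (Nat.not_lt_zero a), fun a ha => absurd ha (Nat.not_lt_zero a)⟩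
    | succ p ih =>
      intro hp
      obtain ⟨e, he⟩ := ih (by omega)
      exact he.exists_succ hw hp
  obtain ⟨e, he⟩ := hst n le_rfl
  have hinj : Function.Injective fun q : Fin n => e q := fun a b hab =>
    Fin.ext (he.inj a a.2 b b.2 hab)
  let E : Equiv.Perm (Fin n) := Equiv.ofBijective _ (Finite.injective_iff_bijective.1 hinj)
  have hE : ∀ q : Fin n, E q = e q := fun q => rfl
  have hPe : ∀ i, e (E.symm i) = i := fun i => E.apply_symm_apply i
  have hP : ∀ (q : ℕ) (hq : q < n) i, e q = i → E.symm i = ⟨q, hq⟩ := by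
    intro q hq i hi
    rw [Equiv.symm_apply_eq, hE, hi]
  refine ⟨E.symm, ?_, ?_, ?_⟩
  · intro i hi
    have h1 := hw.1 i
    have := hP (w i - 1) (by omega) i (he.root i hi h1.2)
    rw [this]
    simp; omega
  · intro i j hij
    obtain ⟨a, ha, hai⟩ := he.closed (E.symm j) (E.symm j).2 i (by rwa [hPe])
    rw [hP a (ha.trans (E.symm j).2) i hai]
    exact ha
  · intro i j i' j' hij hij' hlt
    obtain ⟨a, ha, hai⟩ := he.closed (E.symm j') (E.symm j').2 i' (by rwa [hPe])
    have hEi := hP a (ha.trans (E.symm j').2) i' hai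
    obtain ⟨b, hb, hbj⟩ := he.fifo (E.symm j') (E.symm j').2 a ha (by rwa [hPe, hai])
      (E.symm i) (by rw [hEi] at hlt; exact hlt) j (by rwa [hPe])
    rw [hP b (hb.trans (E.symm j').2) j hbj]
    exact hb

/-- Positions prescribed on the block minima extend to a diagram in which the other elements are
ordered as their predecessors. -/
theorem ArcRel.exists_increasing {r : Fin n → Fin n → Prop} (hr : ArcRel r) {f : Fin n → Fin n}
    (hf : ∀ i j, IsRoot r i → IsRoot r j → f i = f j → i = j) :
    ∃ P : Equiv.Perm (Fin n), (∀ i, IsRoot r i → P i = f i) ∧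
      ∀ i j i' j', r i j → r i' j' → i < i' → P j < P j' := by
  classical
  let rt : Finset (Fin n) := Finset.univ.filter (IsRoot r)
  let B : Finset (Fin n) := Finset.univ.filter fun i => ∃ j, r i j
  have hpred : ∀ j, ¬ IsRoot r j → ∃ i, r i j := fun j hj => by
    simpa only [IsRoot, not_forall, not_not] using hj
  choose! pr hpr using hpred
  have hBimg : B = rtᶜ.image pr := by
    ext i
    simp only [B, rt, Finset.mem_filter, Finset.mem_univ, true_and, Finset.mem_image,
      Finset.mem_compl]
    constructor
    · rintro ⟨j, hj⟩
      have : ¬ IsRoot r j := fun h => h i hj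
      exact ⟨j, this, hr.left (hpr j this) hj⟩
    · rintro ⟨j, hj, rfl⟩
      exact ⟨j, hpr j hj⟩
  have hBcard : B.card = rtᶜ.card := by
    rw [hBimg]
    refine Finset.card_image_of_injOn fun a ha b hb hab => ?_
    simp only [rt, Finset.coe_compl, mem_compl_iff, Finset.mem_coe, Finset.mem_filter,
      Finset.mem_univ, true_and] at ha hb
    exact hr.right (hpr a ha) (by rw [hab]; exact hpr b hb)
  -- Predecessors are unique, so there are as many elements with a successor as non-minima, hence as
  -- positions not taken by minima.
  let C : Finset (Fin n) := (rt.image f)ᶜ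
  have hCcard : C.card = B.card := by
    rw [hBcard, Finset.card_compl, Finset.card_compl, Finset.card_image_of_injOn]
    intro a ha b hb
    exact hf a b (by simpa [rt] using ha) (by simpa [rt] using hb)
  -- A non-minimum is placed at the image of its predecessor, so the order of predecessors becomes
  -- the order of positions.
  let g : B ≃o C := (B.orderIsoOfFin rfl).symm.trans (C.orderIsoOfFin hCcard)
  have hB : ∀ j, ¬ IsRoot r j → pr j ∈ B := fun j hj => by
    simp only [B, Finset.mem_filter, Finset.mem_univ, true_and]
    exact ⟨j, hpr j hj⟩
  let F : Fin n → Fin n := fun j => if h : IsRoot r j then f j else g ⟨pr j, hB j h⟩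
  have hF1 : ∀ j, IsRoot r j → F j = f j := fun j h => dif_pos h
  have hF2 : ∀ j (h : ¬ IsRoot r j), F j = g ⟨pr j, hB j h⟩ := fun j h => dif_neg h
  have hFC : ∀ a b, IsRoot r a → ¬ IsRoot r b → F a ≠ F b := by
    intro a b ha hb hab
    rw [hF1 a ha, hF2 b hb] at hab
    have := (g ⟨pr b, hB b hb⟩).2
    rw [← hab] at this
    simp only [C, rt, Finset.mem_compl, Finset.mem_image, not_exists, Finset.mem_filter,
      Finset.mem_univ, true_and, not_and] at this
    exact this a ha rfl
  have hinj : Function.Injective F := by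
    intro a b hab
    by_cases ha : IsRoot r a <;> by_cases hb : IsRoot r b
    · rw [hF1 a ha, hF1 b hb] at hab
      exact hf a b ha hb hab
    · exact absurd hab (hFC a b ha hb)
    · exact absurd hab.symm (hFC b a hb ha)
    · rw [hF2 a ha, hF2 b hb] at hab
      have := g.injective (Subtype.ext hab)
      have : pr a = pr b := congrArg Subtype.val this
      exact hr.right (hpr a ha) (by rw [this]; exact hpr b hb)
  refine ⟨Equiv.ofBijective F (Finite.injective_iff_bijective.1 hinj), hF1, ?_⟩
  intro i j i' j' hij hij' hlt
  have hj : ¬ IsRoot r j := fun h => h i hij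
  have hj' : ¬ IsRoot r j' := fun h => h i' hij'
  change F j < F j'
  rw [hF2 j hj, hF2 j' hj', Subtype.coe_lt_coe, g.lt_iff_lt, ← Subtype.coe_lt_coe]
  change pr j < pr j'
  rwa [hr.left (hpr j hj) hij, hr.left (hpr j' hj') hij']

/-! ### Realizing order ideals of intervals by points. -/

/-- Every order ideal of intervals is realized by points: the intervals in it are those of length
less than one. -/
theorem exists_realization {K : ℕ → ℕ → Prop}
    (hK : ∀ {a b a' b'}, K a b → a ≤ a' → a' < b' → b' ≤ b → K a' b') (N : ℕ) :
    ∃ t : ℕ → ℝ, ∀ b < N, ∀ a < b, t a < t b ∧ (K a b → t b < t a + 1) ∧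
      (¬ K a b → t a + 1 < t b) := by
  classical
  induction N with
  | zero => exact ⟨0, fun b hb => absurd hb (Nat.not_lt_zero b)⟩
  | succ N ih =>
    obtain ⟨t, ht⟩ := ih
    -- The new largest point must exceed `L` and stay below `U`; the ideal property makes every
    -- lower bound smaller than every upper bound.
    let L : Finset ℝ := (Finset.range N).image t ∪
      ((Finset.range N).filter fun a => ¬ K a N).image fun a => t a + 1
    let U : Finset ℝ := ((Finset.range N).filter fun a => K a N).image fun a => t a + 1
    have hLU : ∀ l ∈ L, ∀ u ∈ U, l < u := by
      intro l hl u hu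
      simp only [L, U, Finset.mem_union, Finset.mem_image, Finset.mem_filter,
        Finset.mem_range] at hl hu
      obtain ⟨a, ⟨ha, hKa⟩, rfl⟩ := hu
      rcases hl with ⟨b, hb, rfl⟩ | ⟨b, ⟨hb, hKb⟩, rfl⟩
      · rcases lt_trichotomy b a with h | rfl | h
        · have := (ht a ha b h).1; linarith
        · linarith
        · exact (ht b hb a h).2.1 (hK hKa le_rfl h hb.le)
      · have hba : b < a := by
          by_contra hge
          exact hKb (hK hKa (not_lt.1 hge) hb le_rfl)
        have := (ht a ha b hba).1; linarith
    obtain ⟨y, hy1, hy2⟩ : ∃ y : ℝ, (∀ l ∈ L, l < y) ∧ ∀ u ∈ U, y < u := 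
      Order.exists_between_finsets L U hLU
    refine ⟨Function.update t N y, fun b hb a hab => ?_⟩
    have hlt : ∀ {a}, a < N → Function.update t N y a = t a := fun h =>
      Function.update_of_ne h.ne _ _
    rcases (Nat.lt_succ_iff.1 hb).lt_or_eq with hb | rfl
    · rw [hlt hb, hlt (hab.trans hb)]
      exact ht b hb a hab
    · rw [hlt hab, Function.update_self]
      refine ⟨hy1 _ ?_, fun h => hy2 _ ?_, fun h => hy1 _ ?_⟩
      · exact Finset.mem_union_left _ (Finset.mem_image_of_mem _ (Finset.mem_range.2 hab))
      · exact Finset.mem_image_of_mem (fun a => t a + 1)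
          (Finset.mem_filter.2 ⟨Finset.mem_range.2 hab, h⟩)
      · exact Finset.mem_union_right _ (Finset.mem_image_of_mem (fun a => t a + 1)
          (Finset.mem_filter.2 ⟨Finset.mem_range.2 hab, h⟩))

theorem eqvGen_comp_equiv_iff {α β : Type*} (f : α ≃ β) {r : β → β → Prop} {a b : α} :
    Relation.EqvGen (fun a b => r (f a) (f b)) a b ↔ Relation.EqvGen r (f a) (f b) := by
  constructor
  · intro h
    induction h with
    | rel _ _ h => exact .rel _ _ h
    | refl => exact .refl _
    | symm _ _ _ ih => exact .symm _ _ ih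
    | trans _ _ _ _ _ ih1 ih2 => exact .trans _ _ _ ih1 ih2
  · have key : ∀ u v, Relation.EqvGen r u v →
        Relation.EqvGen (fun a b => r (f a) (f b)) (f.symm u) (f.symm v) := by
      intro u v h
      induction h with
      | rel _ _ h => exact .rel _ _ (by simpa using h)
      | refl => exact .refl _
      | symm _ _ _ ih => exact .symm _ _ ih
      | trans _ _ _ _ _ ih1 ih2 => exact .trans _ _ _ ih1 ih2
    intro h
    simpa using key _ _ h

/-- The position of each letter in the permutation of a region. -/
noncomputable def pos (R : Set (Fin n → ℝ)) : Equiv.Perm (Fin n) := (regionPerm R).symm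

theorem pos_lt_iff {T : Set (Fin n × Fin n × ℝ)} (hT : coxIdx n ⊆ T) {x : Fin n → ℝ}
    (hx : Generic T x) {a b : Fin n} : pos (cell T x) a < pos (cell T x) b ↔ x b < x a :=
  regionPerm_symm_lt hT hx a b

theorem pos_le_iff {T : Set (Fin n × Fin n × ℝ)} (hT : coxIdx n ⊆ T) {x : Fin n → ℝ}
    (hx : Generic T x) {a b : Fin n} : pos (cell T x) a ≤ pos (cell T x) b ↔ x b ≤ x a := by
  rw [← not_lt, ← not_lt, pos_lt_iff hT hx]

theorem pos_eq_of_lt_iff {T : Set (Fin n × Fin n × ℝ)} (hT : coxIdx n ⊆ T) {x : Fin n → ℝ}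
    (hx : Generic T x) {P : Equiv.Perm (Fin n)} (h : ∀ a b, x b < x a ↔ P a < P b) :
    pos (cell T x) = P := by
  rw [pos, regionPerm_cell_eq hT hx (p := P.symm)]
  · simp
  · intro a b hab
    exact (h _ _).2 (by simpa using hab)

/-! ### Ceilings and labels of the regions of Shi(G). -/

/-- Indices of the hyperplanes of `Shi(G)`. -/
def shiIdx (G : SimpleGraph (Fin n)) : Set (Fin n × Fin n × ℝ) :=
  {t | t.1 < t.2.1 ∧ (t.2.2 = 0 ∨ t.2.2 = 1 ∧ G.Adj t.1 t.2.1)}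

theorem shi_eq_arr (G : SimpleGraph (Fin n)) : shi G = arr (shiIdx G) := by
  ext H
  simp only [shi, cox, arr, shiIdx, mem_union, mem_ofPred_eq]
  constructor
  · rintro (⟨i, j, h, rfl⟩ | ⟨i, j, h, hG, rfl⟩)
    · exact ⟨(i, j, 0), ⟨h, Or.inl rfl⟩, rfl⟩
    · exact ⟨(i, j, 1), ⟨h, Or.inr ⟨rfl, hG⟩⟩, rfl⟩
  · rintro ⟨⟨i, j, c⟩, ⟨h, rfl | ⟨rfl, hG⟩⟩, rfl⟩
    · exact Or.inl ⟨i, j, h, rfl⟩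
    · exact Or.inr ⟨i, j, h, hG, rfl⟩

theorem coxIdx_subset_shiIdx (G : SimpleGraph (Fin n)) : coxIdx n ⊆ shiIdx G :=
  fun _ ht => ⟨ht.1, Or.inl ht.2⟩

theorem finite_shiIdx (G : SimpleGraph (Fin n)) : (shiIdx G).Finite := by
  refine ((finite_univ (α := Fin n)).prod ((finite_univ (α := Fin n)).prod
    (toFinite ({0, 1} : Set ℝ)))).subset ?_
  rintro ⟨i, j, c⟩ ⟨-, h⟩
  refine ⟨mem_univ _, mem_univ _, ?_⟩
  rcases h with h | h
  · exact Or.inl h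
  · exact Or.inr h.1

/-- The combinatorial description of the ceilings of the region of `Shi(G)` containing `x`. -/
structure ShiCeil (G : SimpleGraph (Fin n)) (x : Fin n → ℝ) (i j : Fin n) : Prop where
  lt : i < j
  adj : G.Adj i j
  pos : x j < x i
  lt_one : x i - x j < 1
  max : ∀ i' j', i' < j' → G.Adj i' j' → x i' - x j' < 1 → x i ≤ x i' → x j' ≤ x j →
    i' = i ∧ j' = j

/-- The pairs in `S` generate an order ideal of position intervals. The sign change turns increasing
points into coordinates decreasing with position. -/
theorem exists_realization_shi (Q : Equiv.Perm (Fin n)) (S : Fin n → Fin n → Prop) :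
    ∃ x : Fin n → ℝ, (∀ a b, x b < x a ↔ Q a < Q b) ∧ ∀ a b, Q a < Q b →
      x a - x b ≠ 1 ∧ (x a - x b < 1 ↔ ∃ i j, S i j ∧ Q i ≤ Q a ∧ Q b ≤ Q j) := by
  obtain ⟨t, ht⟩ := exists_realization
    (K := fun a b => ∃ i j, S i j ∧ (Q i : ℕ) ≤ a ∧ b ≤ (Q j : ℕ))
    (by
      rintro a b a' b' ⟨i, j, h, h1, h2⟩ h3 - h4
      exact ⟨i, j, h, h1.trans h3, h4.trans h2⟩) n
  refine ⟨fun a => - t (Q a), fun a b => ?_, fun a b hab => ?_⟩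
  · rw [neg_lt_neg_iff]
    constructor
    · intro h
      by_contra hge
      rcases (not_lt.1 hge).eq_or_lt with he | hlt
      · rw [he] at h; exact lt_irrefl _ h
      · exact absurd h (ht _ (Q a).2 _ hlt).1.not_gt
    · intro h
      exact (ht _ (Q b).2 _ h).1
  · obtain ⟨-, h2, h3⟩ := ht _ (Q b).2 _ hab
    by_cases hK : ∃ i j, S i j ∧ (Q i : ℕ) ≤ Q a ∧ (Q b : ℕ) ≤ (Q j : ℕ)
    · have := h2 hK
      exact ⟨by intro h; linarith, fun _ => hK, fun _ => by linarith⟩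
    · have := h3 hK
      exact ⟨by intro h; linarith, fun h => by linarith, fun h => absurd h hK⟩

theorem generic_shiIdx_iff {G : SimpleGraph (Fin n)} {x : Fin n → ℝ} :
    Generic (shiIdx G) x ↔ Function.Injective x ∧
      ∀ i j, i < j → G.Adj i j → x i - x j ≠ 1 := by
  constructor
  · intro h
    refine ⟨h.injective (coxIdx_subset_shiIdx G), fun i j hij hG hx => ?_⟩
    exact h (i, j, 1) ⟨hij, Or.inr ⟨rfl, hG⟩⟩ (by simp [ev, hx])
  · rintro ⟨h1, h2⟩ ⟨i, j, c⟩ ⟨hij, rfl | ⟨rfl, hG⟩⟩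
    · simpa [ev, sub_eq_zero] using h1.ne hij.ne
    · simpa [ev, sub_eq_zero] using h2 i j hij hG

/-- If an enclosing edge interval also has length below 1, the equation of the facet forces the
endpoints to coincide, against `IsCeiling.exists_ne`. If the interval is maximal, it alone can be
dropped from the generators of the ideal, which gives a point across this hyperplane only. -/
theorem isCeiling_shi_iff {G : SimpleGraph (Fin n)} {x : Fin n → ℝ} (hx : Generic (shiIdx G) x)
    {i j : Fin n} (hij : i < j) :
    IsCeiling (shi G) (cell (shiIdx G) x) (hyper i j 1) ↔ ShiCeil G x i j := by
  have hT := coxIdx_subset_shiIdx G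
  have hinj := hx.injective hT
  have hgen := (generic_shiIdx_iff.1 hx).2
  rw [shi_eq_arr]
  constructor
  · intro h
    have hadj : G.Adj i j := by
      obtain ⟨⟨i', j', c⟩, ⟨hij', rfl | ⟨rfl, hG⟩⟩, heq⟩ := h.1
      · exact absurd (by rw [heq]; simp [hyper]) h.2.1
      · obtain ⟨rfl, rfl, -⟩ := hyper_injective hij.ne (ne_of_lt hij') one_pos one_pos heq
        exact hG
    have ht : (i, j, (1 : ℝ)) ∈ shiIdx G := ⟨hij, Or.inr ⟨rfl, hadj⟩⟩
    have hlt := h.lt_of_cell one_pos ht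
    refine ⟨hij, hadj, ?_, hlt, ?_⟩
    · by_contra hge
      have hlt : x i < x j := lt_of_le_of_ne (not_lt.1 hge) (hinj.ne hij.ne)
      obtain ⟨z, hz, hz1, -⟩ := h.exists_ne hij.ne hij.ne one_ne_zero
      have := le_of_mem_closure_cell hT hz hlt
      linarith
    · intro i' j' hij' hG hlt' hi hj
      by_contra hne
      have hz : ∀ z ∈ closure (cell (shiIdx G) x), z i - z j = 1 → z i = z i' ∧ z j = z j' := by
        intro z hz hz1
        have h1 : z i ≤ z i' := by
          rcases hi.eq_or_lt with h | h
          · rw [hinj h]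
          · exact le_of_mem_closure_cell hT hz h
        have h2 : z j' ≤ z j := by
          rcases hj.eq_or_lt with h | h
          · rw [hinj h]
          · exact le_of_mem_closure_cell hT hz h
        have h3 := closure_cell_subset _ _ hz (i', j', 1) ⟨hij', Or.inr ⟨rfl, hG⟩⟩
        simp only [ev] at h3
        have h4 : z i' - z j' ≤ 1 := by nlinarith
        constructor <;> linarith
      by_cases hii : i' = i
      · have hjj : j ≠ j' := fun h => hne ⟨hii, h.symm⟩
        obtain ⟨z, hzc, hz1, hz2⟩ := h.exists_ne hij.ne hjj one_ne_zero
        exact hz2 (hz z hzc hz1).2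
      · obtain ⟨z, hzc, hz1, hz2⟩ := h.exists_ne hij.ne (Ne.symm hii) one_ne_zero
        exact hz2 (hz z hzc hz1).1
  · intro h
    set Q := pos (cell (shiIdx G) x)
    have hQ : ∀ {a b}, Q a ≤ Q b ↔ x b ≤ x a := pos_le_iff hT hx
    have hQ' : ∀ {a b}, Q a < Q b ↔ x b < x a := pos_lt_iff hT hx
    obtain ⟨x', h1, h2⟩ := exists_realization_shi Q
      (fun a b => a < b ∧ G.Adj a b ∧ x a - x b < 1 ∧ ¬ (a = i ∧ b = j))
    have h1' : ∀ a b, x' b < x' a ↔ x b < x a := fun a b => (h1 a b).trans hQ'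
    have hsub : ∀ a b, x a < x b → x' a < x' b := fun a b h => (h1' b a).2 h
    refine isCeiling_of_flip (finite_shiIdx G) (x' := x') hij.ne one_pos
      ⟨hij, Or.inr ⟨rfl, h.adj⟩⟩ hx h.lt_one ?_ ?_
    · obtain ⟨h3, h4⟩ := h2 i j (hQ'.2 h.pos)
      by_contra hle
      have hlt : x' i - x' j < 1 := lt_of_le_of_ne (not_lt.1 hle) h3
      obtain ⟨a, b, ⟨hab, hG, hlt1, hne⟩, ha, hb⟩ := h4.1 hlt
      exact hne (h.max a b hab hG hlt1 (hQ.1 ha) (hQ.1 hb))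
    · rintro ⟨a, b, c⟩ ⟨hab, rfl | ⟨rfl, hG⟩⟩ hne
      · simp only [ev, sub_zero]
        rcases lt_or_gt_of_ne (hinj.ne (ne_of_lt hab)) with h' | h'
        · exact mul_pos_of_neg_of_neg (sub_neg.2 h') (sub_neg.2 (hsub _ _ h'))
        · exact mul_pos (sub_pos.2 h') (sub_pos.2 (hsub _ _ h'))
      · simp only [ev]
        change a < b at hab
        change G.Adj a b at hG
        rcases lt_or_gt_of_ne (hinj.ne (ne_of_lt hab)) with h' | h'
        · have := hsub _ _ h'
          exact mul_pos_of_neg_of_neg (by linarith) (by linarith)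
        · obtain ⟨h3, h4⟩ := h2 a b (hQ'.2 h')
          rcases lt_or_gt_of_ne (hgen a b hab hG) with h5 | h5
          · have h6 := h4.2 ⟨a, b, ⟨hab, hG, h5, fun hc => hne (by rw [hc.1, hc.2])⟩,
              le_rfl, le_rfl⟩
            exact mul_pos_of_neg_of_neg (by linarith) (by linarith)
          · have h6 : ¬ x' a - x' b < 1 := by
              intro hlt
              obtain ⟨i', j', ⟨-, -, h7, -⟩, h8, h9⟩ := h4.1 hlt
              have := hQ.1 h8
              have := hQ.1 h9
              linarith
            have h7 : 1 < x' a - x' b := lt_of_le_of_ne (not_lt.1 h6) (Ne.symm h3)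
            exact mul_pos (by linarith) (by linarith)

/-- Two maximal intervals with a common endpoint are nested, hence equal. -/
theorem arcRel_shiCeil {G : SimpleGraph (Fin n)} {x : Fin n → ℝ} : ArcRel (ShiCeil G x) where
  lt h := h.lt
  right := by
    intro i j k hj hk
    rcases le_total (x j) (x k) with h | h
    · exact (hk.max _ _ hj.lt hj.adj hj.lt_one le_rfl h).2
    · exact (hj.max _ _ hk.lt hk.adj hk.lt_one le_rfl h).2.symm
  left := by
    intro i j k hi hj
    rcases le_total (x i) (x j) with h | h
    · exact (hi.max _ _ hj.lt hj.adj hj.lt_one h le_rfl).1.symm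
    · exact (hj.max _ _ hi.lt hi.adj hi.lt_one h le_rfl).1

theorem ShiCeil.nonnesting {G : SimpleGraph (Fin n)} {x : Fin n → ℝ} {i j i' j' : Fin n}
    (h : ShiCeil G x i j) (h' : ShiCeil G x i' j') (hlt : x i' < x i) : x j' < x j := by
  by_contra hge
  obtain ⟨rfl, -⟩ := h'.max i j h.lt h.adj h.lt_one hlt.le (not_lt.1 hge)
  exact lt_irrefl _ hlt

theorem exists_shiCeil {G : SimpleGraph (Fin n)} {x : Fin n → ℝ} (hx : Function.Injective x)
    {a b : Fin n} (hab : a < b) (hG : G.Adj a b) (hlt : x b < x a) (h1 : x a - x b < 1) :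
    ∃ i j, ShiCeil G x i j ∧ x a ≤ x i ∧ x j ≤ x b := by
  -- An enclosing short edge of greatest length is maximal for inclusion.
  obtain ⟨⟨i, j⟩, ⟨hij, hG', h1', hi, hj⟩, hmax⟩ := exists_max_image
    {p : Fin n × Fin n | p.1 < p.2 ∧ G.Adj p.1 p.2 ∧ x p.1 - x p.2 < 1 ∧ x a ≤ x p.1 ∧
      x p.2 ≤ x b} (fun p => x p.1 - x p.2) (toFinite _) ⟨(a, b), hab, hG, h1, le_rfl, le_rfl⟩
  refine ⟨i, j, ⟨hij, hG', by simp only at hi hj; linarith, h1', ?_⟩, hi, hj⟩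
  intro i' j' hij' hG'' h1'' hi' hj'
  have := hmax (i', j') ⟨hij', hG'', h1'', hi.trans hi', hj'.trans hj⟩
  simp only at this
  exact ⟨hx (by linarith), hx (by linarith)⟩

/-- Consequently a Shi region is determined by its permutation and its ceilings. -/
theorem lt_one_iff_exists_shiCeil {G : SimpleGraph (Fin n)} {x : Fin n → ℝ}
    (hx : Function.Injective x) {a b : Fin n} (hab : a < b) (hG : G.Adj a b) (hlt : x b < x a) :
    x a - x b < 1 ↔ ∃ i j, ShiCeil G x i j ∧ x a ≤ x i ∧ x j ≤ x b := by
  refine ⟨exists_shiCeil hx hab hG hlt, ?_⟩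
  rintro ⟨i, j, h, hi, hj⟩
  have := h.lt_one
  linarith

theorem shiCeilingPartition_cell {G : SimpleGraph (Fin n)} {x : Fin n → ℝ}
    (hx : Generic (shiIdx G) x) :
    shiCeilingPartition G (cell (shiIdx G) x) = Relation.EqvGen.setoid (ShiCeil G x) := by
  unfold shiCeilingPartition
  congr 1
  ext i j
  exact ⟨fun h => (isCeiling_shi_iff hx h.1).1 h.2,
    fun h => ⟨h.lt, (isCeiling_shi_iff hx h.lt).2 h⟩⟩

theorem shiDiagramPartition_cell {G : SimpleGraph (Fin n)} {x : Fin n → ℝ}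
    (hx : Generic (shiIdx G) x) (a b : Fin n) :
    shiDiagramPartition G (cell (shiIdx G) x) a b ↔ Relation.EqvGen (ShiCeil G x)
      (regionPerm (cell (shiIdx G) x) a) (regionPerm (cell (shiIdx G) x) b) := by
  rw [← eqvGen_comp_equiv_iff]
  unfold shiDiagramPartition
  have : (fun i j => regionPerm (cell (shiIdx G) x) i < regionPerm (cell (shiIdx G) x) j ∧
      IsCeiling (shi G) (cell (shiIdx G) x) (hyper (regionPerm (cell (shiIdx G) x) i)
        (regionPerm (cell (shiIdx G) x) j) 1)) = fun i j => ShiCeil G x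
          (regionPerm (cell (shiIdx G) x) i) (regionPerm (cell (shiIdx G) x) j) := by
    ext i j
    exact ⟨fun h => (isCeiling_shi_iff hx h.1).1 h.2,
      fun h => ⟨h.lt, (isCeiling_shi_iff hx h.lt).2 h⟩⟩
  rw [this]
  rfl

theorem shiWord_cell {G : SimpleGraph (Fin n)} {x : Fin n → ℝ} (hx : Generic (shiIdx G) x)
    (i : Fin n) : shiWord G (cell (shiIdx G) x) i =
      sInf {m : ℕ | ∃ k, Relation.EqvGen (ShiCeil G x) k i ∧
        m = (pos (cell (shiIdx G) x) k : ℕ) + 1} := by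
  unfold shiWord
  congr 1
  ext m
  simp only [mem_ofPred_eq, shiDiagramPartition_cell hx, Equiv.apply_symm_apply, pos]
  constructor
  · rintro ⟨b, hb, rfl⟩
    exact ⟨_, hb, by simp⟩
  · rintro ⟨k, hk, rfl⟩
    exact ⟨(regionPerm (cell (shiIdx G) x)).symm k, by simpa using hk, rfl⟩

theorem shiWord_eq_of_shiCeil {G : SimpleGraph (Fin n)} {x : Fin n → ℝ}
    (hx : Generic (shiIdx G) x) (i j : Fin n) (h : ShiCeil G x i j) :
    shiWord G (cell (shiIdx G) x) i = shiWord G (cell (shiIdx G) x) j := by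
  rw [shiWord_cell hx, shiWord_cell hx]
  congr 1
  ext m
  refine exists_congr fun k => and_congr_left fun _ => ?_
  exact ⟨fun h' => .trans _ _ _ h' (.rel _ _ h),
    fun h' => .trans _ _ _ h' (.symm _ _ (.rel _ _ h))⟩

/-- Positions increase along ceilings, so the smallest number in a block also has the smallest
position. -/
theorem shiWord_of_isRoot {G : SimpleGraph (Fin n)} {x : Fin n → ℝ} (hx : Generic (shiIdx G) x)
    (i : Fin n) (h : IsRoot (ShiCeil G x) i) :
    shiWord G (cell (shiIdx G) x) i = (pos (cell (shiIdx G) x) i : ℕ) + 1 := by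
  rw [shiWord_cell hx]
  refine IsLeast.csInf_eq ⟨⟨i, .refl _, rfl⟩, ?_⟩
  rintro m ⟨k, hk, rfl⟩
  have hT := coxIdx_subset_shiIdx G
  have key : ∀ {a b}, Relation.ReflTransGen (ShiCeil G x) a b →
      pos (cell (shiIdx G) x) a ≤ pos (cell (shiIdx G) x) b := by
    intro a b hab
    induction hab with
    | refl => exact le_rfl
    | tail _ h ih => exact ih.trans ((pos_lt_iff hT hx).2 h.pos).le
  rcases arcRel_shiCeil.eqvGen_iff.1 hk with h' | h'
  · rcases h'.cases_tail with rfl | ⟨c, -, hc⟩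
    · exact le_rfl
    · exact absurd hc (h c)
  · have := key h'
    simpa using this

theorem ker_shiWord {G : SimpleGraph (Fin n)} {x : Fin n → ℝ} (hx : Generic (shiIdx G) x) :
    Setoid.ker (shiWord G (cell (shiIdx G) x)) = Relation.EqvGen.setoid (ShiCeil G x) := by
  refine arcRel_shiCeil.ker_eq (shiWord_eq_of_shiCeil hx) fun i j hi hj h => ?_
  rw [shiWord_of_isRoot hx i hi, shiWord_of_isRoot hx j hj] at h
  exact (pos (cell (shiIdx G) x)).injective (Fin.ext (by omega))

theorem isArc_ker_shiWord {G : SimpleGraph (Fin n)} {x : Fin n → ℝ}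
    (hx : Generic (shiIdx G) x) :
    IsArc (Setoid.ker (shiWord G (cell (shiIdx G) x))) = ShiCeil G x := by
  ext i j
  rw [ker_shiWord hx, arcRel_shiCeil.isArc_eqvGen]

/-- Each letter is at most the one-based position of its index, and the positions form a
permutation. -/
theorem shiWord_mem {G : SimpleGraph (Fin n)} {x : Fin n → ℝ} (hx : Generic (shiIdx G) x) :
    shiWord G (cell (shiIdx G) x) ∈ {w | w ∈ Park n ∧ ArcsIn G w} := by
  have hT := coxIdx_subset_shiIdx G
  have hle : ∀ i, 1 ≤ shiWord G (cell (shiIdx G) x) i ∧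
      shiWord G (cell (shiIdx G) x) i ≤ (pos (cell (shiIdx G) x) i : ℕ) + 1 := by
    intro j
    induction j using WellFoundedLT.induction with
    | _ j ih =>
      by_cases h : IsRoot (ShiCeil G x) j
      · rw [shiWord_of_isRoot hx j h]; omega
      · simp only [IsRoot, not_forall, not_not] at h
        obtain ⟨k, hk⟩ := h
        rw [← shiWord_eq_of_shiCeil hx k j hk]
        have h1 := ih k hk.lt
        have h2 : ((pos (cell (shiIdx G) x) k : Fin n) : ℕ) < pos (cell (shiIdx G) x) j :=
          (pos_lt_iff hT hx).2 hk.pos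
        omega
  constructor
  · rw [park_iff]
    refine ⟨fun i => ⟨(hle i).1, (hle i).2.trans (pos (cell (shiIdx G) x) i).2⟩, fun k hk => ?_⟩
    let f : Fin k ↪ Fin n := (Fin.castLEEmb hk).trans (pos (cell (shiIdx G) x)).symm.toEmbedding
    calc k = (Finset.univ.map f).card := by simp
      _ ≤ _ := Finset.card_le_card fun i hi => by
        simp only [Finset.mem_map, Finset.mem_univ, true_and] at hi
        obtain ⟨a, rfl⟩ := hi
        simp only [Finset.mem_filter, Finset.mem_univ, true_and]
        refine (hle _).2.trans ?_
        simp [f]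
  · intro i j hij
    rw [isArc_ker_shiWord hx] at hij
    exact hij.adj

/-- The arcs of the word are the ceilings, and its letters on block minima are positions; nonnesting
then recovers the permutation, and with it the region. -/
theorem shiWord_injOn (G : SimpleGraph (Fin n)) : InjOn (shiWord G) (regions (shi G)) := by
  rw [shi_eq_arr, regions_arr]
  rintro _ ⟨x, hx, rfl⟩ _ ⟨y, hy, rfl⟩ hxy
  have hT := coxIdx_subset_shiIdx G
  have hceil : ShiCeil G x = ShiCeil G y := by
    rw [← isArc_ker_shiWord hx, ← isArc_ker_shiWord hy, hxy]
  have hpos : pos (cell (shiIdx G) x) = pos (cell (shiIdx G) y) := by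
    refine (arcRel_shiCeil (G := G) (x := x)).nonnesting_unique ?_ ?_ ?_ ?_ ?_
    · intro i hi
      have h1 := shiWord_of_isRoot hx i hi
      rw [hceil] at hi
      have h2 := shiWord_of_isRoot hy i hi
      rw [hxy] at h1
      exact Fin.ext (by omega)
    · exact fun i j h => (pos_lt_iff hT hx).2 h.pos
    · intro i j h
      rw [hceil] at h
      exact (pos_lt_iff hT hy).2 h.pos
    · intro i j i' j' h h' hlt
      exact (pos_lt_iff hT hx).2 (h.nonnesting h' ((pos_lt_iff hT hx).1 hlt))
    · intro i j i' j' h h' hlt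
      rw [hceil] at h h'
      exact (pos_lt_iff hT hy).2 (h.nonnesting h' ((pos_lt_iff hT hy).1 hlt))
  have hlt : ∀ a b, x a < x b ↔ y a < y b := fun a b => by
    rw [← pos_lt_iff hT hx, hpos, pos_lt_iff hT hy]
  have hle : ∀ a b, x a ≤ x b ↔ y a ≤ y b := fun a b => by
    rw [← pos_le_iff hT hx, hpos, pos_le_iff hT hy]
  refine (cell_eq_of_mem ((mem_cell_iff hx hy).2 ?_)).symm
  rintro ⟨a, b, c⟩ ⟨hab, rfl | ⟨rfl, hG⟩⟩
  · simpa [ev] using hlt a b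
  · simp only [ev, sub_neg]
    change a < b at hab
    change G.Adj a b at hG
    have hxi := hx.injective hT
    rcases lt_or_gt_of_ne (hxi.ne (ne_of_lt hab)) with h | h
    · have h' := (hlt _ _).1 h
      exact iff_of_true (by linarith) (by linarith)
    · have h' := (hlt _ _).1 h
      rw [lt_one_iff_exists_shiCeil hxi hab hG h,
        lt_one_iff_exists_shiCeil (hy.injective hT) hab hG h', hceil]
      simp only [hle]

/-- In a nonnesting diagram no arc interval contains another, so the arcs are exactly the maximal
short edges of a point realizing the ideal they generate. -/
theorem shiWord_surjOn (G : SimpleGraph (Fin n)) :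
    SurjOn (shiWord G) (regions (shi G)) {w | w ∈ Park n ∧ ArcsIn G w} := by
  rw [shi_eq_arr, regions_arr]
  rintro w ⟨hw, hG⟩
  have hT := coxIdx_subset_shiIdx G
  have hr := arcRel_isArc (Setoid.ker w)
  obtain ⟨P, hP1, hP2, hP3⟩ := exists_nonnesting hw
  obtain ⟨x, hx1, hx2⟩ := exists_realization_shi P (IsArc (Setoid.ker w))
  have hinj : Function.Injective x := by
    intro a b hab
    by_contra hne
    rcases lt_or_gt_of_ne (P.injective.ne hne) with h | h
    · exact ((hx1 _ _).2 h).ne hab.symm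
    · exact ((hx1 _ _).2 h).ne hab
  have hle : ∀ a b, x b ≤ x a ↔ P a ≤ P b := fun a b => by
    rw [← not_lt, hx1, not_lt]
  have hx : Generic (shiIdx G) x := by
    refine generic_shiIdx_iff.2 ⟨hinj, fun i j hij _ h => ?_⟩
    have : x j < x i := by linarith
    exact (hx2 i j ((hx1 _ _).1 this)).1 h
  have hpos := pos_eq_of_lt_iff hT hx hx1
  have hone : ∀ {i j}, IsArc (Setoid.ker w) i j → x i - x j < 1 := fun {i j} h =>
    (hx2 i j (hP2 i j h)).2.2 ⟨i, j, h, le_rfl, le_rfl⟩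
  have huniq : ∀ {i j i' j'}, IsArc (Setoid.ker w) i j → IsArc (Setoid.ker w) i' j' →
      P i' ≤ P i → P j ≤ P j' → i' = i ∧ j' = j := by
    intro i j i' j' h h' h1 h2
    rcases h1.eq_or_lt with he | hlt
    · have := P.injective he
      subst this
      exact ⟨rfl, hr.right h' h⟩
    · exact absurd (hP3 _ _ _ _ h' h hlt) h2.not_gt
  have hceil : ∀ i j, ShiCeil G x i j ↔ IsArc (Setoid.ker w) i j := by
    intro i j
    constructor
    · intro h
      obtain ⟨i', j', h', hi, hj⟩ := (hx2 i j ((hx1 _ _).1 h.pos)).2.1 h.lt_one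
      obtain ⟨rfl, rfl⟩ := h.max i' j' h'.1 (hG _ _ h') (hone h') ((hle _ _).2 hi)
        ((hle _ _).2 hj)
      exact h'
    · intro h
      refine ⟨h.1, hG _ _ h, (hx1 _ _).2 (hP2 _ _ h), hone h, ?_⟩
      intro i' j' hij' hG' h1 hi hj
      have hlt : x j' < x i' := (hj.trans_lt ((hx1 _ _).2 (hP2 _ _ h))).trans_le hi
      obtain ⟨i'', j'', h'', hi', hj'⟩ := (hx2 i' j' ((hx1 _ _).1 hlt)).2.1 h1
      obtain ⟨rfl, rfl⟩ := huniq h h'' (hi'.trans ((hle _ _).1 hi)) (((hle _ _).1 hj).trans hj')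
      exact ⟨hinj (le_antisymm ((hle _ _).2 hi') hi), hinj (le_antisymm hj ((hle _ _).2 hj'))⟩
  have hceil' : ShiCeil G x = IsArc (Setoid.ker w) := by
    ext i j; exact hceil i j
  refine ⟨_, ⟨x, hx, rfl⟩, ?_⟩
  refine hr.word_ext (fun i j h => shiWord_eq_of_shiCeil hx i j ((hceil i j).2 h))
    (fun i j h => isArc_ker_eq h) fun i hi => ?_
  rw [shiWord_of_isRoot hx i (hceil' ▸ hi), hpos, hP1 i hi]

theorem shiWord_bijOn (G : SimpleGraph (Fin n)) :
    BijOn (shiWord G) (regions (shi G)) {w | w ∈ Park n ∧ ArcsIn G w} := by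
  refine ⟨?_, shiWord_injOn G, shiWord_surjOn G⟩
  rw [shi_eq_arr, regions_arr]
  rintro _ ⟨x, hx, rfl⟩
  exact shiWord_mem hx

/-! ### Ceilings of the regions of Ish(G). -/

/-- Indices of the hyperplanes of `Ish(G)`. -/
def ishIdx [NeZero n] (G : SimpleGraph (Fin n)) : Set (Fin n × Fin n × ℝ) :=
  coxIdx n ∪ {t | ∃ i j : Fin n, i < j ∧ G.Adj i j ∧ t = (0, j, (i : ℝ) + 1)}

theorem ish_eq_arr [NeZero n] (G : SimpleGraph (Fin n)) : ish G = arr (ishIdx G) := by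
  ext H
  simp only [ish, cox, arr, ishIdx, coxIdx, mem_union, mem_ofPred_eq]
  constructor
  · rintro (⟨i, j, h, rfl⟩ | ⟨i, j, h, hG, rfl⟩)
    · exact ⟨(i, j, 0), Or.inl ⟨h, rfl⟩, rfl⟩
    · exact ⟨_, Or.inr ⟨i, j, h, hG, rfl⟩, rfl⟩
  · rintro ⟨⟨i, j, c⟩, ⟨h, rfl⟩ | ⟨i', j', h, hG, heq⟩, rfl⟩
    · exact Or.inl ⟨i, j, h, rfl⟩
    · rw [heq]
      exact Or.inr ⟨i', j', h, hG, rfl⟩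

theorem coxIdx_subset_ishIdx [NeZero n] (G : SimpleGraph (Fin n)) : coxIdx n ⊆ ishIdx G :=
  subset_union_left

theorem finite_ishIdx [NeZero n] (G : SimpleGraph (Fin n)) : (ishIdx G).Finite := by
  refine ((finite_univ (α := Fin n)).prod ((finite_univ (α := Fin n)).prod
    ((finite_singleton (0 : ℝ)).union (finite_range fun i : Fin n => (i : ℝ) + 1)))).subset ?_
  rintro ⟨i, j, c⟩ (⟨-, h⟩ | ⟨i', j', -, -, h⟩)
  · exact ⟨mem_univ _, mem_univ _, Or.inl h⟩
  · refine ⟨mem_univ _, mem_univ _, Or.inr ⟨i', ?_⟩⟩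
    simp only [Prod.mk.injEq] at h
    exact h.2.2.symm

/-- The combinatorial description of the ceilings of the region of `Ish(G)` containing `x`. -/
structure IshCeil [NeZero n] (G : SimpleGraph (Fin n)) (x : Fin n → ℝ) (i j : Fin n) : Prop where
  lt : i < j
  adj : G.Adj i j
  pos : x j < x 0
  below : x 0 - x j < i + 1
  max : ∀ i' k, i' < k → G.Adj i' k → x 0 - x k < i' + 1 → x k ≤ x j → i < i' ∨ i' = i ∧ k = j

/-- With `x' 0 = 0`, a coordinate below `x 0` is moved strictly between `-V k` and `1 - V k`, so
comparison with integer levels sees only `V k`. The sigmoid orders coordinates with equal `V` as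
before. -/
theorem exists_realization_ish [NeZero n] {x : Fin n → ℝ} (hx : Function.Injective x)
    (S : Fin n → Fin n → Prop) : ∃ x' : Fin n → ℝ, (∀ a b, x' b < x' a ↔ x b < x a) ∧
      ∀ k, x k < x 0 → ∀ i : Fin n, x' 0 - x' k ≠ i + 1 ∧
        (x' 0 - x' k < i + 1 ↔ ∃ i' k', S i' k' ∧ x k' ≤ x k ∧ i' ≤ i) := by
  classical
  -- The value `n + 1` exceeds every level `i + 1` and keeps the set nonempty, so its infimum is
  -- attained.
  let B : Fin n → Set ℕ := fun k =>
    {m | m = n + 1 ∨ ∃ i k', S i k' ∧ x k' ≤ x k ∧ m = (i : ℕ) + 1}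
  let V : Fin n → ℕ := fun k => sInf (B k)
  have hVmem : ∀ k, V k ∈ B k := fun k => Nat.sInf_mem ⟨n + 1, Or.inl rfl⟩
  have hVle : ∀ {k m}, m ∈ B k → V k ≤ m := fun h => Nat.sInf_le h
  have hV1 : ∀ k, 1 ≤ V k := fun k => by
    rcases hVmem k with h | ⟨i, -, -, -, h⟩ <;> omega
  have hVmono : ∀ {a b}, x b ≤ x a → V a ≤ V b := fun {a b} h => by
    refine hVle ?_
    rcases hVmem b with h' | ⟨i, k', h1, h2, h3⟩
    · exact Or.inl h'
    · exact Or.inr ⟨i, k', h1, h2.trans h, h3⟩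
  have hViff : ∀ k (i : Fin n), V k ≤ i + 1 ↔ ∃ i' k', S i' k' ∧ x k' ≤ x k ∧ i' ≤ i := by
    intro k i
    constructor
    · intro h
      rcases hVmem k with h' | ⟨i', k', h1, h2, h3⟩
      · omega
      · exact ⟨i', k', h1, h2, Fin.le_def.2 (by omega)⟩
    · rintro ⟨i', k', h1, h2, h3⟩
      have h4 := hVle (Or.inr ⟨i', k', h1, h2, rfl⟩ : (i' : ℕ) + 1 ∈ B k)
      have : (i' : ℕ) ≤ i := h3
      omega
  let x' : Fin n → ℝ := fun k => if x k < x 0 then Real.sigmoid (x k) - V k else x k - x 0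
  have hx'1 : ∀ {k}, x k < x 0 → x' k = Real.sigmoid (x k) - V k := fun h => if_pos h
  have hx'2 : ∀ {k}, ¬ x k < x 0 → x' k = x k - x 0 := fun h => if_neg h
  have hx0 : x' 0 = 0 := by rw [hx'2 (lt_irrefl _), sub_self]
  have hmono : ∀ {a b}, x b < x a → x' b < x' a := by
    intro a b hab
    by_cases ha : x a < x 0
    · rw [hx'1 ha, hx'1 (hab.trans ha)]
      have h1 := Real.sigmoid_strictMono hab
      have h2 : (V a : ℝ) ≤ V b := Nat.cast_le.2 (hVmono hab.le)
      linarith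
    · rw [hx'2 ha]
      by_cases hb : x b < x 0
      · rw [hx'1 hb]
        have h1 := Real.sigmoid_lt_one (x b)
        have h2 : (1 : ℝ) ≤ V b := by exact_mod_cast hV1 b
        linarith
      · rw [hx'2 hb]; linarith
  refine ⟨x', fun a b => ⟨fun h => ?_, hmono⟩, fun k hk i => ?_⟩
  · by_contra hge
    rcases (not_lt.1 hge).eq_or_lt with he | hlt
    · rw [hx he] at h; exact lt_irrefl _ h
    · exact (hmono hlt).not_gt h
  · rw [hx0, hx'1 hk, ← hViff]
    have h1 := Real.sigmoid_lt_one (x k)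
    have h2 := Real.sigmoid_pos (x k)
    rcases le_or_gt (V k) (i + 1) with h | h
    · have h' : (V k : ℝ) ≤ i + 1 := by exact_mod_cast h
      exact ⟨by intro h; linarith, fun _ => h, fun _ => by linarith⟩
    · have h' : (i : ℝ) + 1 + 1 ≤ V k := by exact_mod_cast h
      exact ⟨by intro h; linarith, fun h => by linarith, fun h2 => absurd h2 h.not_ge⟩

theorem generic_ishIdx_iff [NeZero n] {G : SimpleGraph (Fin n)} {x : Fin n → ℝ} :
    Generic (ishIdx G) x ↔ Function.Injective x ∧
      ∀ i j, i < j → G.Adj i j → x 0 - x j ≠ i + 1 := by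
  constructor
  · intro h
    refine ⟨h.injective (coxIdx_subset_ishIdx G), fun i j hij hG hx => ?_⟩
    exact h _ (Or.inr ⟨i, j, hij, hG, rfl⟩) (by simp [ev, hx])
  · rintro ⟨h1, h2⟩ ⟨a, b, c⟩ (⟨hij, rfl⟩ | ⟨i, j, hij, hG, h⟩)
    · simpa [ev, sub_eq_zero] using h1.ne (ne_of_lt hij)
    · rw [h]
      exact sub_ne_zero.2 (h2 i j hij hG)

theorem zero_ne_of_lt [NeZero n] {i j : Fin n} (h : i < j) : (0 : Fin n) ≠ j := by
  rintro rfl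
  exact Fin.not_lt_zero _ h

/-- A bound at most as high on a coordinate at most as large implies the given one; on the facet it
would force equal levels and equal coordinates. An irredundant bound can be dropped alone from the
generators in `exists_realization_ish`. -/
theorem isCeiling_ish_iff [NeZero n] {G : SimpleGraph (Fin n)} {x : Fin n → ℝ}
    (hx : Generic (ishIdx G) x) {i j : Fin n} (hij : i < j) :
    IsCeiling (ish G) (cell (ishIdx G) x) (hyper 0 j ((i : ℝ) + 1)) ↔ IshCeil G x i j := by
  have hT := coxIdx_subset_ishIdx G
  have hinj := hx.injective hT
  have hgen := (generic_ishIdx_iff.1 hx).2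
  have h0j := zero_ne_of_lt hij
  have hpos : ∀ a : Fin n, (0 : ℝ) < a + 1 := fun a => by positivity
  rw [ish_eq_arr]
  constructor
  · intro h
    have hadj : G.Adj i j := by
      obtain ⟨⟨i', j', c⟩, ⟨-, rfl⟩ | ⟨i'', j'', hij', hG, ht⟩, heq⟩ := h.1
      · exact absurd (by rw [heq]; simp [hyper]) h.2.1
      · rw [ht] at heq
        obtain ⟨-, rfl, hc⟩ := hyper_injective h0j (zero_ne_of_lt hij') (hpos i) (hpos i'') heq
        have : i = i'' := Fin.ext (by exact_mod_cast add_right_cancel hc)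
        rwa [this]
    have ht : ((0 : Fin n), j, (i : ℝ) + 1) ∈ ishIdx G := Or.inr ⟨i, j, hij, hadj, rfl⟩
    have hlt := h.lt_of_cell (hpos i) ht
    refine ⟨hij, hadj, ?_, hlt, ?_⟩
    · by_contra hge
      have hlt : x 0 < x j := lt_of_le_of_ne (not_lt.1 hge) (hinj.ne h0j)
      obtain ⟨z, hz, hz1, -⟩ := h.exists_ne h0j h0j (hpos i).ne'
      have := le_of_mem_closure_cell hT hz hlt
      have := hpos i
      linarith
    · intro i' k hik hG hlt' hkj
      by_contra hne
      push Not at hne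
      have hz : ∀ z ∈ closure (cell (ishIdx G) x), z 0 - z j = i + 1 → z j = z k ∧ i' = i := by
        intro z hz hz1
        have h1 : z k ≤ z j := by
          rcases hkj.eq_or_lt with h | h
          · rw [hinj h]
          · exact le_of_mem_closure_cell hT hz h
        have h3 := closure_cell_subset _ _ hz (0, k, (i' : ℝ) + 1) (Or.inr ⟨i', k, hik, hG, rfl⟩)
        simp only [ev] at h3
        have h4 : z 0 - z k ≤ i' + 1 := by nlinarith
        have h5 : (i' : ℝ) ≤ i := by exact_mod_cast hne.1
        refine ⟨by linarith, le_antisymm hne.1 ?_⟩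
        have : (i : ℝ) ≤ i' := by linarith
        exact_mod_cast this
      by_cases hk : k = j
      · obtain ⟨z, hzc, hz1, -⟩ := h.exists_ne h0j h0j (hpos i).ne'
        exact hne.2 (hz z hzc hz1).2 hk
      · obtain ⟨z, hzc, hz1, hz2⟩ := h.exists_ne h0j (Ne.symm hk) (hpos i).ne'
        exact hz2 (hz z hzc hz1).1
  · intro h
    obtain ⟨x', h1, h2⟩ := exists_realization_ish hinj
      (fun a b => a < b ∧ G.Adj a b ∧ x 0 - x b < a + 1 ∧ ¬ (a = i ∧ b = j))
    refine isCeiling_of_flip (finite_ishIdx G) (x' := x') h0j (hpos i)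
      (Or.inr ⟨i, j, hij, h.adj, rfl⟩) hx h.below ?_ ?_
    · obtain ⟨h3, h4⟩ := h2 j h.pos i
      by_contra hle
      have hlt : x' 0 - x' j < i + 1 := lt_of_le_of_ne (not_lt.1 hle) h3
      obtain ⟨a, b, ⟨hab, hG, hlt1, hne⟩, hb, ha⟩ := h4.1 hlt
      rcases h.max a b hab hG hlt1 hb with hc | hc
      · exact absurd hc ha.not_gt
      · exact hne hc
    · rintro ⟨a, b, c⟩ (⟨hab, rfl⟩ | ⟨a, b, hab, hG, ht⟩) hne
      · simp only [ev, sub_zero]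
        rcases lt_or_gt_of_ne (hinj.ne (ne_of_lt hab)) with h' | h'
        · exact mul_pos_of_neg_of_neg (sub_neg.2 h') (sub_neg.2 ((h1 _ _).2 h'))
        · exact mul_pos (sub_pos.2 h') (sub_pos.2 ((h1 _ _).2 h'))
      · rw [ht] at hne ⊢
        simp only [ev]
        have := hpos a
        rcases lt_or_gt_of_ne (hinj.ne (zero_ne_of_lt hab)) with h' | h'
        · have := (h1 _ _).2 h'
          exact mul_pos_of_neg_of_neg (by linarith) (by linarith)
        · obtain ⟨h3, h4⟩ := h2 b h' a
          rcases lt_or_gt_of_ne (hgen a b hab hG) with h5 | h5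
          · have h6 := h4.2 ⟨a, b, ⟨hab, hG, h5, fun hc => hne (by rw [hc.1, hc.2])⟩,
              le_rfl, le_rfl⟩
            exact mul_pos_of_neg_of_neg (by linarith) (by linarith)
          · have h6 : ¬ x' 0 - x' b < a + 1 := by
              intro hlt
              obtain ⟨i', j', ⟨-, -, h7, -⟩, h8, h9⟩ := h4.1 hlt
              have : (i' : ℝ) ≤ a := by exact_mod_cast h9
              linarith
            have h7 : (a : ℝ) + 1 < x' 0 - x' b := lt_of_le_of_ne (not_lt.1 h6) (Ne.symm h3)
            exact mul_pos (by linarith) (by linarith)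

/-- At one level the bound on the smaller coordinate is stronger, and for one coordinate the bound
at the lower level is. -/
theorem arcRel_ishCeil [NeZero n] {G : SimpleGraph (Fin n)} {x : Fin n → ℝ} :
    ArcRel (IshCeil G x) where
  lt h := h.lt
  right := by
    intro i j k hj hk
    rcases le_total (x j) (x k) with h | h
    · exact ((hk.max _ _ hj.lt hj.adj hj.below h).resolve_left (lt_irrefl _)).2
    · exact ((hj.max _ _ hk.lt hk.adj hk.below h).resolve_left (lt_irrefl _)).2.symm
  left := by
    intro i j k hi hj
    rcases hi.max _ _ hj.lt hj.adj hj.below le_rfl with h | h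
    · rcases hj.max _ _ hi.lt hi.adj hi.below le_rfl with h' | h'
      · exact absurd h h'.not_gt
      · exact h'.1
    · exact h.1.symm

/-- Otherwise the lower bound would make the higher one redundant. This is the counterpart of
`ShiCeil.nonnesting`. -/
theorem IshCeil.increasing [NeZero n] {G : SimpleGraph (Fin n)} {x : Fin n → ℝ}
    {i j i' j' : Fin n} (h : IshCeil G x i j) (h' : IshCeil G x i' j') (hlt : i < i') :
    x j' < x j := by
  by_contra hge
  rcases h'.max i j h.lt h.adj h.below (not_lt.1 hge) with hc | hc
  · exact absurd hc hlt.not_gt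
  · exact hlt.ne hc.1

theorem below_iff_exists_ishCeil [NeZero n] {G : SimpleGraph (Fin n)} {x : Fin n → ℝ}
    (hx : Function.Injective x) {a b : Fin n} (hab : a < b) (hG : G.Adj a b) (hlt : x b < x 0) :
    x 0 - x b < a + 1 ↔ ∃ i j, IshCeil G x i j ∧ i ≤ a ∧ x j ≤ x b := by
  constructor
  · intro h
    let A : Set (Fin n × Fin n) := {p | p.1 < p.2 ∧ G.Adj p.1 p.2 ∧ x 0 - x p.2 < p.1 + 1 ∧
      p.1 ≤ a ∧ x p.2 ≤ x b}
    -- The strongest bound minimizes the level first, and then the coordinate.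
    obtain ⟨⟨i, j₀⟩, hi, himin⟩ := exists_min_image A (fun p => p.1) (toFinite _)
      ⟨(a, b), hab, hG, h, le_rfl, le_rfl⟩
    obtain ⟨⟨i₁, j⟩, ⟨⟨hij, hG', hb, hia, hjb⟩, hii⟩, hjmin⟩ :=
      exists_min_image (A ∩ {p | p.1 = i}) (fun p => x p.2) (toFinite _) ⟨(i, j₀), hi, rfl⟩
    simp only [mem_ofPred_eq] at hii
    subst hii
    refine ⟨i₁, j, ⟨hij, hG', hjb.trans_lt hlt, hb, ?_⟩, hia, hjb⟩
    intro i' k hik hG'' hb' hkj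
    rcases lt_or_ge i₁ i' with hc | hc
    · exact Or.inl hc
    · have hmem : (i', k) ∈ A := ⟨hik, hG'', hb', hc.trans hia, hkj.trans hjb⟩
      have he : i' = i₁ := le_antisymm hc (himin _ hmem)
      have := hjmin (i', k) ⟨hmem, he⟩
      exact Or.inr ⟨he, hx (le_antisymm hkj this)⟩
  · rintro ⟨i, j, h, hi, hj⟩
    have := h.below
    have : (i : ℝ) ≤ a := by exact_mod_cast hi
    linarith

theorem ishCeilingPartition_cell [NeZero n] {G : SimpleGraph (Fin n)} {x : Fin n → ℝ}
    (hx : Generic (ishIdx G) x) :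
    ishCeilingPartition G (cell (ishIdx G) x) = Relation.EqvGen.setoid (IshCeil G x) := by
  unfold ishCeilingPartition
  congr 1
  ext i j
  exact ⟨fun h => (isCeiling_ish_iff hx h.1).1 h.2,
    fun h => ⟨h.lt, (isCeiling_ish_iff hx h.lt).2 h⟩⟩

theorem ishDots_eq [NeZero n] {G : SimpleGraph (Fin n)} {x : Fin n → ℝ}
    (hx : Generic (ishIdx G) x) (j : Fin n) :
    ishDots G (cell (ishIdx G) x) ((regionPerm (cell (ishIdx G) x)).symm j) =
      sInf {m : ℕ | ∃ i, IshCeil G x i j ∧ m = (i : ℕ) + 1} := by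
  unfold ishDots
  congr 1
  ext m
  simp only [Equiv.apply_symm_apply, mem_ofPred_eq]
  refine exists_congr fun i => ⟨?_, ?_⟩
  · rintro ⟨h1, h2, h3⟩
    exact ⟨(isCeiling_ish_iff hx h1).1 h2, h3⟩
  · rintro ⟨h1, h2⟩
    exact ⟨h1.lt, (isCeiling_ish_iff hx h1.lt).2 h1, h2⟩

theorem ishDots_of_ishCeil [NeZero n] {G : SimpleGraph (Fin n)} {x : Fin n → ℝ}
    (hx : Generic (ishIdx G) x) {i j : Fin n} (h : IshCeil G x i j) :
    ishDots G (cell (ishIdx G) x) ((regionPerm (cell (ishIdx G) x)).symm j) = (i : ℕ) + 1 := by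
  rw [ishDots_eq hx]
  have : {m : ℕ | ∃ i, IshCeil G x i j ∧ m = (i : ℕ) + 1} = {(i : ℕ) + 1} := by
    ext m
    simp only [mem_ofPred_eq, mem_singleton_iff]
    constructor
    · rintro ⟨i', h', rfl⟩
      rw [arcRel_ishCeil.left h' h]
    · rintro rfl
      exact ⟨i, h, rfl⟩
  rw [this, csInf_singleton]

theorem ishDots_of_isRoot [NeZero n] {G : SimpleGraph (Fin n)} {x : Fin n → ℝ}
    (hx : Generic (ishIdx G) x) {j : Fin n} (h : IsRoot (IshCeil G x) j) :
    ishDots G (cell (ishIdx G) x) ((regionPerm (cell (ishIdx G) x)).symm j) = 0 := by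
  rw [ishDots_eq hx]
  have : {m : ℕ | ∃ i, IshCeil G x i j ∧ m = (i : ℕ) + 1} = ∅ := by
    ext m
    simp only [mem_ofPred_eq, mem_empty_iff_false, iff_false]
    rintro ⟨i', h', rfl⟩
    exact h i' h'
  rw [this, Nat.sInf_empty]

/-! ### Rook placements, lasers and rook words. -/

/-- The placement with rooks in the squares `(j, n + i)` for the arcs `i < j` and in the squares
`(j, f j)` for the block minima `j`. -/
def placement (r : Fin n → Fin n → Prop) (f : Fin n → ℕ) : Set (ℕ × ℕ) :=
  {p | (∃ i j, r i j ∧ p = ((j : ℕ) + 1, n + ((i : ℕ) + 1))) ∨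
    ∃ j, IsRoot r j ∧ p = ((j : ℕ) + 1, f j)}

/-- The conditions under which `placement r f` is a valid placement. -/
structure PlacementData [NeZero n] (G : SimpleGraph (Fin n)) (r : Fin n → Fin n → Prop)
    (f : Fin n → ℕ) : Prop where
  arc : ArcRel r
  adj : ∀ i j, r i j → G.Adj i j
  one_le : ∀ j, IsRoot r j → 1 ≤ f j
  le : ∀ j, IsRoot r j → f j ≤ n
  inj : ∀ i j, IsRoot r i → IsRoot r j → f i = f j → i = j
  fill : ∀ a, 1 ≤ a → a < f 0 → ∃ j, IsRoot r j ∧ f j = a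

theorem ArcRel.isRoot_zero [NeZero n] {r : Fin n → Fin n → Prop} (hr : ArcRel r) :
    IsRoot r 0 := fun _ h => Fin.not_lt_zero _ (hr.lt h)

theorem placement_congr {r : Fin n → Fin n → Prop} {f g : Fin n → ℕ}
    (h : ∀ j, IsRoot r j → f j = g j) : placement r f = placement r g := by
  ext p
  refine or_congr_right (exists_congr fun j => and_congr_right fun hj => ?_)
  rw [h j hj]

theorem PlacementData.arc_mem_iff [NeZero n] {G : SimpleGraph (Fin n)}
    {r : Fin n → Fin n → Prop} {f : Fin n → ℕ} (h : PlacementData G r f) {i j : Fin n} :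
    ((j : ℕ) + 1, n + ((i : ℕ) + 1)) ∈ placement r f ↔ r i j := by
  constructor
  · rintro (⟨i', j', h', he⟩ | ⟨j', hj', he⟩)
    · simp only [Prod.mk.injEq] at he
      rwa [show i = i' from Fin.ext (by omega), show j = j' from Fin.ext (by omega)]
    · simp only [Prod.mk.injEq] at he
      have := h.le j' hj'
      omega
  · exact fun h => Or.inl ⟨i, j, h, rfl⟩

theorem PlacementData.root_mem_iff [NeZero n] {G : SimpleGraph (Fin n)}
    {r : Fin n → Fin n → Prop} {f : Fin n → ℕ} (h : PlacementData G r f) {j : Fin n} {a : ℕ} :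
    ((j : ℕ) + 1, a) ∈ placement r f ∧ a ≤ n ↔ IsRoot r j ∧ a = f j := by
  constructor
  · rintro ⟨⟨i', j', h', he⟩ | ⟨j', hj', he⟩, ha⟩
    · simp only [Prod.mk.injEq] at he
      omega
    · simp only [Prod.mk.injEq] at he
      rw [show j = j' from Fin.ext (by omega)]
      exact ⟨hj', he.2⟩
  · rintro ⟨hj, rfl⟩
    exact ⟨Or.inr ⟨j, hj, rfl⟩, h.le j hj⟩

theorem PlacementData.congr_of_eq [NeZero n] {G : SimpleGraph (Fin n)}
    {r s : Fin n → Fin n → Prop} {f g : Fin n → ℕ} (h : PlacementData G r f)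
    (h' : PlacementData G s g) (he : placement r f = placement s g) :
    r = s ∧ ∀ j, IsRoot r j → f j = g j := by
  refine ⟨?_, fun j hj => ?_⟩
  · ext i j
    rw [← h.arc_mem_iff, ← h'.arc_mem_iff, he]
  · have := h.root_mem_iff.2 ⟨hj, rfl⟩
    rw [he] at this
    exact (h'.root_mem_iff.1 this).2

theorem PlacementData.isRookPlacement [NeZero n] {G : SimpleGraph (Fin n)}
    {r : Fin n → Fin n → Prop} {f : Fin n → ℕ} (h : PlacementData G r f) :
    IsRookPlacement (boardHatOf G) (placement r f) := by
  constructor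
  · rintro p (⟨i, j, hij, rfl⟩ | ⟨j, hj, rfl⟩)
    · have h1 : (i : ℕ) < j := h.arc.lt hij
      refine ⟨⟨by simp, by simp, by simp; omega, by simp; omega⟩, fun i' j' he => ?_⟩
      simp only [Prod.mk.injEq] at he
      rw [show i' = i from Fin.ext (by omega), show j' = j from Fin.ext (by omega)]
      exact h.adj i j hij
    · have h1 := h.one_le j hj
      have h2 := h.le j hj
      refine ⟨⟨by simp, by simp, h1, by simp; omega⟩, fun i' j' he => ?_⟩
      simp only [Prod.mk.injEq] at he
      omega
  · have hcol : ∀ p ∈ placement r f, ∀ q ∈ placement r f, p.1 = q.1 → p.2 = q.2 := by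
      rintro p (⟨i, j, hij, rfl⟩ | ⟨j, hj, rfl⟩) q (⟨i', j', hij', rfl⟩ | ⟨j', hj', rfl⟩) he
      all_goals
        have hjj : j = j' := Fin.ext (by simpa using he)
        subst hjj
      · rw [h.arc.left hij hij']
      · exact absurd hij (hj' i)
      · exact absurd hij' (hj i')
      · rfl
    have hrow : ∀ p ∈ placement r f, ∀ q ∈ placement r f, p.2 = q.2 → p.1 = q.1 := by
      rintro p (⟨i, j, hij, rfl⟩ | ⟨j, hj, rfl⟩) q (⟨i', j', hij', rfl⟩ | ⟨j', hj', rfl⟩) he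
      · have hii : i = i' := Fin.ext (by simpa using he)
        subst hii
        rw [h.arc.right hij hij']
      · have := h.le j' hj'
        simp only at he
        omega
      · have := h.le j hj
        simp only at he
        omega
      · rw [h.inj j j' hj hj' he]
    intro p hp q hq hne
    exact ⟨fun he => hne (Prod.ext he (hcol p hp q hq he)),
      fun he => hne (Prod.ext (hrow p hp q hq he) he)⟩

theorem exists_mem_placement (r : Fin n → Fin n → Prop) (f : Fin n → ℕ) (j : Fin n) :
    ∃ a, ((j : ℕ) + 1, a) ∈ placement r f := by
  by_cases hj : IsRoot r j
  · exact ⟨f j, Or.inr ⟨j, hj, rfl⟩⟩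
  · simp only [IsRoot, not_forall, not_not] at hj
    obtain ⟨i, hi⟩ := hj
    exact ⟨_, Or.inl ⟨i, j, hi, rfl⟩⟩

/-- A rook in every column leaves no room for another, whence maximality; `fill` supplies the rooks
in the rows below the first one. -/
theorem PlacementData.mem_validPlacements [NeZero n] {G : SimpleGraph (Fin n)}
    {r : Fin n → Fin n → Prop} {f : Fin n → ℕ} (h : PlacementData G r f) :
    placement r f ∈ validPlacements G := by
  refine ⟨⟨h.isRookPlacement, fun Q hQ hsub q hq => ?_⟩, fun a ha b hb hba => ?_⟩
  · obtain ⟨⟨h1, h2, -, -⟩, -⟩ := hQ.1 hq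
    obtain ⟨a, ha⟩ := exists_mem_placement r f ⟨q.1 - 1, by omega⟩
    simp only [Nat.sub_add_cancel h1] at ha
    by_contra hcon
    have hne : q ≠ (q.1, a) := fun he => hcon (by rw [he]; exact ha)
    exact (hQ.2 q hq _ (hsub ha) hne).1 rfl
  · have h0 := h.arc.isRoot_zero
    have ha' : a = f 0 := by
      have h1 : (((0 : Fin n) : ℕ) + 1, f 0) ∈ placement r f := Or.inr ⟨0, h0, rfl⟩
      by_contra hne
      exact (h.isRookPlacement.2 _ ha _ h1 (by simpa using hne)).1 (by simp)
    obtain ⟨j, hj, rfl⟩ := h.fill b hb (ha' ▸ hba)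
    exact ⟨_, Or.inr ⟨j, hj, rfl⟩⟩

/-- If column `j` were empty, some row up to `n` would be empty too, since `n` rooks in these rows
occupy all `n` columns. No square in these rows is ever deleted, so a rook could be added. -/
theorem exists_rook_of_maximal {G : SimpleGraph (Fin n)} {P : Set (ℕ × ℕ)}
    (hP : Maximal (IsRookPlacement (boardHatOf G)) P) (j : Fin n) :
    ∃ a, ((j : ℕ) + 1, a) ∈ P := by
  by_contra hcon
  push Not at hcon
  obtain ⟨a, ha⟩ : ∃ a : Fin n, ∀ c, (c, (a : ℕ) + 1) ∉ P := by
    by_contra hfull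
    push Not at hfull
    choose c hc using hfull
    have hcb : ∀ a, 1 ≤ c a ∧ c a ≤ n := fun a =>
      ⟨(hP.1.1 (hc a)).1.1, (hP.1.1 (hc a)).1.2.1⟩
    let g : Fin n → Fin n := fun a => ⟨c a - 1, by have := hcb a; omega⟩
    have hg : Function.Injective g := by
      intro a b hab
      have h1 : c a - 1 = c b - 1 := congrArg Fin.val hab
      have h2 := hcb a
      have h3 := hcb b
      by_contra hne
      have := (hP.1.2 _ (hc a) _ (hc b) (fun he => hne (Fin.ext (by
        simp only [Prod.mk.injEq] at he; omega)))).1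
      simp only at this
      omega
    obtain ⟨a, ha⟩ := (Finite.injective_iff_surjective.1 hg) j
    have h1 : c a - 1 = j := congrArg Fin.val ha
    have h2 := hcb a
    apply hcon ((a : ℕ) + 1)
    rw [← h1, Nat.sub_add_cancel h2.1]
    exact hc a
  have hins : IsRookPlacement (boardHatOf G) (insert ((j : ℕ) + 1, (a : ℕ) + 1) P) := by
    constructor
    · rintro p (rfl | hp)
      · refine ⟨⟨by simp, by simp, by simp, by simp; omega⟩, fun i' j' he => ?_⟩
        simp only [Prod.mk.injEq] at he
        omega
      · exact hP.1.1 hp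
    · rintro ⟨p1, p2⟩ (hp | hp) ⟨q1, q2⟩ (hq | hq) hne
      · exact absurd (hp.trans hq.symm) hne
      · simp only [Prod.mk.injEq] at hp
        obtain ⟨rfl, rfl⟩ := hp
        exact ⟨by rintro rfl; exact hcon _ hq, by rintro rfl; exact ha _ hq⟩
      · simp only [Prod.mk.injEq] at hq
        obtain ⟨rfl, rfl⟩ := hq
        exact ⟨by rintro rfl; exact hcon _ hp, by rintro rfl; exact ha _ hp⟩
      · exact hP.1.2 _ hp _ hq hne
  exact hcon _ (hP.2 hins (subset_insert _ _) (mem_insert _ _))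

/-- Valid placements are the placements given by arcs and rows of the block minima. -/
theorem exists_placementData [NeZero n] {G : SimpleGraph (Fin n)} {P : Set (ℕ × ℕ)}
    (hP : P ∈ validPlacements G) : ∃ r f, PlacementData G r f ∧ P = placement r f := by
  obtain ⟨hmax, hfill⟩ := hP
  choose f hf using exists_rook_of_maximal hmax
  have hcol : ∀ c a b, (c, a) ∈ P → (c, b) ∈ P → a = b := by
    intro c a b ha hb
    by_contra hne
    exact (hmax.1.2 _ ha _ hb (by simpa using hne)).1 rfl
  have hrow : ∀ a c d, (c, a) ∈ P → (d, a) ∈ P → c = d := by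
    intro a c d hc hd
    by_contra hne
    exact (hmax.1.2 _ hc _ hd (by simpa using hne)).2 rfl
  let r : Fin n → Fin n → Prop := fun i j => ((j : ℕ) + 1, n + ((i : ℕ) + 1)) ∈ P
  have hroot : ∀ j, IsRoot r j ↔ f j ≤ n := by
    intro j
    constructor
    · intro hj
      by_contra hgt
      obtain ⟨⟨-, -, -, h4⟩, -⟩ := hmax.1.1 (hf j)
      simp only at h4
      refine hj ⟨f j - n - 1, by omega⟩ ?_
      change ((j : ℕ) + 1, n + (f j - n - 1 + 1)) ∈ P
      rw [show n + (f j - n - 1 + 1) = f j by omega]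
      exact hf j
    · intro hle i hi
      have := hcol _ _ _ hi (hf j)
      omega
  have hdata : PlacementData G r f := by
    refine ⟨⟨?_, ?_, ?_⟩, ?_, ?_, ?_, ?_, ?_⟩
    · intro i j hij
      have := (hmax.1.1 hij).1.2.2.2
      simp only at this
      exact Fin.lt_def.2 (by omega)
    · intro i j k hj hk
      have := hrow _ _ _ hj hk
      exact Fin.ext (by omega)
    · intro i j k hi hj
      have := hcol _ _ _ hi hj
      exact Fin.ext (by omega)
    · exact fun i j hij => (hmax.1.1 hij).2 i j rfl
    · exact fun j _ => (hmax.1.1 (hf j)).1.2.2.1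
    · exact fun j hj => (hroot j).1 hj
    · intro i j _ _ he
      have := hrow _ _ _ (hf i) (he ▸ hf j)
      exact Fin.ext (by omega)
    · intro a ha ha0
      have h0 := hf 0
      simp only [Fin.val_zero, zero_add] at h0
      obtain ⟨c, hc⟩ := hfill _ h0 a ha ha0
      obtain ⟨⟨h1, h2, -, -⟩, -⟩ := hmax.1.1 hc
      simp only at h1 h2
      have hfc : f ⟨c - 1, by omega⟩ = a := by
        refine hcol c _ _ ?_ hc
        have := hf ⟨c - 1, by omega⟩
        simpa only [Nat.sub_add_cancel h1] using this
      refine ⟨⟨c - 1, by omega⟩, (hroot _).2 ?_, hfc⟩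
      rw [hfc]
      have h0n : f 0 ≤ n := (hroot 0).1 fun i hi => by
        have := (hmax.1.1 hi).1.2.2.2
        simp at this
      omega
  refine ⟨r, f, hdata, ?_⟩
  apply Subset.antisymm
  · rintro ⟨c, a⟩ hp
    obtain ⟨⟨h1, h2, -, -⟩, -⟩ := hmax.1.1 hp
    simp only at h1 h2
    obtain ⟨j, rfl⟩ : ∃ j : Fin n, c = j + 1 := ⟨⟨c - 1, by omega⟩, by simp; omega⟩
    by_cases hj : IsRoot r j
    · exact Or.inr ⟨j, hj, by rw [hcol _ _ _ hp (hf j)]⟩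
    · simp only [IsRoot, not_forall, not_not] at hj
      obtain ⟨i, hi⟩ := hj
      exact Or.inl ⟨i, j, hi, by rw [hcol _ _ _ hp hi]⟩
  · rintro p (⟨i, j, hij, rfl⟩ | ⟨j, hj, rfl⟩)
    · exact hij
    · exact hf j

theorem PlacementData.exists_arc [NeZero n] {G : SimpleGraph (Fin n)}
    {r : Fin n → Fin n → Prop} {f : Fin n → ℕ} (h : PlacementData G r f) {j : Fin n} {i : ℕ}
    (hi : 1 ≤ i) (hmem : ((j : ℕ) + 1, n + i) ∈ placement r f) :
    ∃ i' : Fin n, i = i' + 1 ∧ r i' j := by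
  obtain ⟨i', j', hij, he⟩ | ⟨j', hj', he⟩ := hmem
  · simp only [Prod.mk.injEq] at he
    rw [show j = j' from Fin.ext (by omega)]
    exact ⟨i', by omega, hij⟩
  · simp only [Prod.mk.injEq] at he
    have := h.le j' hj'
    omega

theorem PlacementData.laserEnd_iff [NeZero n] {G : SimpleGraph (Fin n)}
    {r : Fin n → Fin n → Prop} {f : Fin n → ℕ} (h : PlacementData G r f) {j : Fin n} {e : ℕ} :
    LaserEnd n (placement r f) ((j : ℕ) + 1) e ↔
      ∃ i, r i j ∧ (IsRoot r i ∧ e = f i ∨ LaserEnd n (placement r f) ((i : ℕ) + 1) e) := by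
  have hfwd : ∀ {j : Fin n}, LaserEnd n (placement r f) ((j : ℕ) + 1) e →
      ∃ i, r i j ∧ (IsRoot r i ∧ e = f i ∨ LaserEnd n (placement r f) ((i : ℕ) + 1) e) := by
    intro j hl
    generalize hc : (j : ℕ) + 1 = c at hl
    rcases hl with ⟨_, i, _, hi, hmem, hie, hen⟩ | ⟨_, i, k, _, hi, hmem, hik, hnk, hl⟩
    · subst hc
      obtain ⟨i', rfl, hij⟩ := h.exists_arc hi hmem
      exact ⟨i', hij, Or.inl (h.root_mem_iff.1 ⟨hie, hen⟩)⟩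
    · subst hc
      obtain ⟨i', rfl, hij⟩ := h.exists_arc hi hmem
      exact ⟨i', hij, Or.inr hl⟩
  refine ⟨hfwd, ?_⟩
  rintro ⟨i, hij, h' | h'⟩
  · obtain ⟨h1, h2⟩ := h.root_mem_iff.2 h'
    exact .ofBelow _ (i + 1) _ (by omega) (h.arc_mem_iff.2 hij) h1 h2
  · obtain ⟨k, hk, -⟩ := hfwd h'
    exact .ofAbove _ (i + 1) _ _ (by omega) (h.arc_mem_iff.2 hij) (h.arc_mem_iff.2 hk)
      (by omega) h'

/-- A laser is handed down from predecessor to predecessor and ends in the row of the block minimum.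
The squares are counted on the full board, so deleted squares do not lower the count. -/
theorem PlacementData.laserWord_spec [NeZero n] {G : SimpleGraph (Fin n)}
    {r : Fin n → Fin n → Prop} {f : Fin n → ℕ} (h : PlacementData G r f) :
    (∀ i j, r i j → laserWord (placement r f) i = (laserWord (placement r f) j : ℕ)) ∧
      ∀ j : Fin n, IsRoot r j → laserWord (placement r f) j = f j := by
  choose rt hrt1 hrt2 using h.arc.exists_root
  have hrt3 : ∀ {j}, IsRoot r j → rt j = j := fun {j} hj => by
    rcases (hrt2 j).cases_tail with he | ⟨c, -, hc⟩
    · exact he.symm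
    · exact absurd hc (hj c)
  have hrt4 : ∀ {i j}, r i j → rt i = rt j := fun {i j} hij => by
    rcases (hrt2 j).cases_tail with he | ⟨c, h1, hc⟩
    · have := hrt1 j
      rw [← he] at this
      exact absurd hij (this i)
    · rw [h.arc.left hc hij] at h1
      have h2 : Relation.EqvGen r (rt i) (rt j) := .trans _ _ _
        (h.arc.eqvGen_iff.2 (Or.inl (hrt2 i))) (.symm _ _ (h.arc.eqvGen_iff.2 (Or.inl h1)))
      rcases h.arc.eqvGen_iff.1 h2 with h3 | h3
      · rcases h3.cases_tail with he | ⟨c, -, hc⟩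
        · exact he.symm
        · exact absurd hc (hrt1 j c)
      · rcases h3.cases_tail with he | ⟨c, -, hc⟩
        · exact he
        · exact absurd hc (hrt1 i c)
  have hend : ∀ j, ¬ IsRoot r j → ∀ e, LaserEnd n (placement r f) ((j : ℕ) + 1) e ↔
      e = f (rt j) := by
    intro j
    induction j using WellFoundedLT.induction with
    | _ j ih =>
      intro hj e
      simp only [IsRoot, not_forall, not_not] at hj
      obtain ⟨i, hij⟩ := hj
      rw [h.laserEnd_iff, ← hrt4 hij]
      constructor
      · rintro ⟨i', hij', h'⟩
        rw [h.arc.left hij' hij] at h'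
        rcases h' with ⟨hi, rfl⟩ | h'
        · rw [hrt3 hi]
        · refine (ih i (h.arc.lt hij) (fun hi => ?_) e).1 h'
          obtain ⟨k, hk, -⟩ := h.laserEnd_iff.1 h'
          exact hi k hk
      · rintro rfl
        refine ⟨i, hij, ?_⟩
        by_cases hi : IsRoot r i
        · exact Or.inl ⟨hi, by rw [hrt3 hi]⟩
        · exact Or.inr ((ih i (h.arc.lt hij) hi _).2 rfl)
  have hword : ∀ j : Fin n, laserWord (placement r f) j = f (rt j) := by
    intro j
    have hle := h.le _ (hrt1 j)
    have hset : {a : ℕ | ((j : ℕ) + 1, a) ∈ boardHat n ∧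
        (∃ b, ((j : ℕ) + 1, b) ∈ placement r f ∧ a ≤ b) ∧
          ∀ e, LaserEnd n (placement r f) ((j : ℕ) + 1) e → a ≤ e} =
        Icc 1 (f (rt j)) := by
      ext a
      simp only [boardHat, mem_ofPred_eq, mem_Icc]
      by_cases hj : IsRoot r j
      · rw [hrt3 hj] at hle ⊢
        constructor
        · rintro ⟨⟨-, -, h1, -⟩, ⟨b, hb, hab⟩, -⟩
          rcases hb with ⟨i', j', hij, he⟩ | ⟨j', hj', he⟩
          · simp only [Prod.mk.injEq] at he
            exact absurd (show r i' j by rwa [show j = j' from Fin.ext (by omega)]) (hj i')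
          · simp only [Prod.mk.injEq] at he
            rw [show j = j' from Fin.ext (by omega), ← he.2]
            exact ⟨h1, hab⟩
        · rintro ⟨h1, h2⟩
          refine ⟨⟨by omega, by omega, h1, by omega⟩, ⟨f j, Or.inr ⟨j, hj, rfl⟩, h2⟩, ?_⟩
          intro e he
          obtain ⟨k, hk, -⟩ := h.laserEnd_iff.1 he
          exact absurd hk (hj k)
      · constructor
        · rintro ⟨⟨-, -, h1, -⟩, -, h2⟩
          exact ⟨h1, h2 _ ((hend j hj _).2 rfl)⟩
        · rintro ⟨h1, h2⟩
          have hj' := hj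
          simp only [IsRoot, not_forall, not_not] at hj'
          obtain ⟨i, hij⟩ := hj'
          refine ⟨⟨by omega, by omega, h1, by omega⟩,
            ⟨_, Or.inl ⟨i, j, hij, rfl⟩, by omega⟩, fun e he => ?_⟩
          rw [(hend j hj e).1 he]
          exact h2
    unfold laserWord
    rw [hset, ncard_eq_toFinset_card']
    simp
  exact ⟨fun i j hij => by rw [hword, hword, hrt4 hij], fun j hj => by rw [hword, hrt3 hj]⟩

theorem PlacementData.ker_laserWord [NeZero n] {G : SimpleGraph (Fin n)}
    {r : Fin n → Fin n → Prop} {f : Fin n → ℕ} (h : PlacementData G r f) :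
    Setoid.ker (laserWord (n := n) (placement r f)) = Relation.EqvGen.setoid r :=
  h.arc.ker_eq h.laserWord_spec.1 fun i j hi hj he =>
    h.inj i j hi hj (by rwa [h.laserWord_spec.2 i hi, h.laserWord_spec.2 j hj] at he)

theorem PlacementData.isArc_ker_laserWord [NeZero n] {G : SimpleGraph (Fin n)}
    {r : Fin n → Fin n → Prop} {f : Fin n → ℕ} (h : PlacementData G r f) :
    IsArc (Setoid.ker (laserWord (n := n) (placement r f))) = r := by
  ext i j
  rw [h.ker_laserWord, h.arc.isArc_eqvGen]

theorem PlacementData.laserWord_mem [NeZero n] {G : SimpleGraph (Fin n)}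
    {r : Fin n → Fin n → Prop} {f : Fin n → ℕ} (h : PlacementData G r f) :
    laserWord (placement r f) ∈ {w | w ∈ Rook n ∧ ArcsIn G w} := by
  obtain ⟨h1, h2⟩ := h.laserWord_spec
  refine ⟨⟨fun j => ?_, fun a ha ha0 => ?_⟩, fun i j hij => ?_⟩
  · obtain ⟨i, hi, hij⟩ := h.arc.exists_root j
    rw [← eq_of_reflTransGen h1 hij, h2 i hi]
    exact ⟨h.one_le i hi, h.le i hi⟩
  · rw [h2 0 h.arc.isRoot_zero] at ha0
    rcases ha0.eq_or_lt with rfl | hlt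
    · exact ⟨0, h2 0 h.arc.isRoot_zero⟩
    · obtain ⟨j, hj, rfl⟩ := h.fill a ha hlt
      exact ⟨j, h2 j hj⟩
  · rw [h.isArc_ker_laserWord] at hij
    exact h.adj i j hij

/-- For `fill`, an index carrying a given letter may be replaced by the minimum of its block. -/
theorem placementData_of_rook [NeZero n] {G : SimpleGraph (Fin n)} {w : Fin n → ℕ}
    (hw : w ∈ Rook n) (hG : ArcsIn G w) : PlacementData G (IsArc (Setoid.ker w)) w where
  arc := arcRel_isArc _
  adj := hG
  one_le j _ := (hw.1 j).1
  le j _ := (hw.1 j).2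
  inj _ _ hi hj he := isRoot_ker_unique hi hj he
  fill a ha ha0 := by
    obtain ⟨j, rfl⟩ := hw.2 a ha ha0.le
    obtain ⟨i, hi, hij⟩ := (arcRel_isArc (Setoid.ker w)).exists_root j
    exact ⟨i, hi, eq_of_reflTransGen (fun _ _ h => isArc_ker_eq h) hij⟩

theorem laserWord_bijOn [NeZero n] (G : SimpleGraph (Fin n)) :
    BijOn laserWord (validPlacements G) {w | w ∈ Rook n ∧ ArcsIn G w} := by
  refine ⟨?_, ?_, ?_⟩
  · intro P hP
    obtain ⟨r, f, h, rfl⟩ := exists_placementData hP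
    exact h.laserWord_mem
  · intro P hP Q hQ he
    obtain ⟨r, f, h, rfl⟩ := exists_placementData hP
    obtain ⟨s, g, h', rfl⟩ := exists_placementData hQ
    have hrs : r = s := by rw [← h.isArc_ker_laserWord, ← h'.isArc_ker_laserWord, he]
    subst hrs
    refine placement_congr fun j hj => ?_
    rw [← h.laserWord_spec.2 j hj, ← h'.laserWord_spec.2 j hj, he]
  · rintro w ⟨hw, hG⟩
    have h := placementData_of_rook hw hG
    exact ⟨_, h.mem_validPlacements, h.arc.word_ext h.laserWord_spec.1
      (fun _ _ h => isArc_ker_eq h) h.laserWord_spec.2⟩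

/-! ### The cycle lemma, and rook words as orbit representatives. -/

theorem SameOrbit.symm {v w : Fin n → ℕ} (h : SameOrbit v w) : SameOrbit w v := by
  obtain ⟨c, hc⟩ := h
  -- Modulo `n + 1`, multiplication by `n` is negation.
  refine ⟨n * c, fun i => ?_⟩
  calc w i + n * c ≡ v i + c + n * c [MOD n + 1] := (hc i).symm.add_right _
    _ = v i + (n + 1) * c := by ring
    _ ≡ v i [MOD n + 1] := by simp [Nat.ModEq]

theorem SameOrbit.trans {u v w : Fin n → ℕ} (h : SameOrbit u v) (h' : SameOrbit v w) :
    SameOrbit u w := by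
  obtain ⟨c, hc⟩ := h
  obtain ⟨d, hd⟩ := h'
  exact ⟨c + d, fun i => by
    rw [← add_assoc]; exact ((hc i).add_right d).trans (hd i)⟩

theorem eq_of_modEq_of_mem {a b : ℕ} (h : a ≡ b [MOD n + 1]) (ha : a ≤ n) (hb : b ≤ n) :
    a = b := Nat.ModEq.eq_of_lt_of_lt h (by omega) (by omega)

theorem SameOrbit.ker_eq {v w : Fin n → ℕ} (h : SameOrbit v w) (hv : ∀ i, v i ≤ n)
    (hw : ∀ i, w i ≤ n) : Setoid.ker v = Setoid.ker w := by
  obtain ⟨c, hc⟩ := h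
  ext i j
  simp only [Setoid.ker_def]
  constructor
  · intro he
    refine eq_of_modEq_of_mem ((hc i).symm.trans ?_) (hw i) (hw j)
    rw [he]; exact hc j
  · intro he
    refine eq_of_modEq_of_mem (Nat.ModEq.add_right_cancel' c ((hc i).trans ?_)) (hv i) (hv j)
    rw [he]; exact (hc j).symm

/-- The number of letters of `v` in `[1, k]`, counted cyclically modulo `n + 1`. -/
def cyclicCount (v : Fin n → ℕ) (k : ℕ) : ℕ :=
  ∑ m ∈ Finset.range k, (Finset.univ.filter fun i => v i ≡ m + 1 [MOD n + 1]).card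

/-- The letters of `w` in `[1, k]` are the letters of `v` in the window from `a + 1` to `a + k`,
which contains each residue at most once. -/
theorem card_add_cyclicCount {v w : Fin n → ℕ} {a : ℕ} (h : ∀ i, v i ≡ w i + a [MOD n + 1])
    (hw : ∀ i, 1 ≤ w i ∧ w i ≤ n + 1) {k : ℕ} (hk : k ≤ n + 1) :
    (Finset.univ.filter fun i => w i ≤ k).card + cyclicCount v a = cyclicCount v (a + k) := by
  induction k with
  | zero =>
    have : (Finset.univ.filter fun i => w i ≤ 0) = ∅ := by
      ext i
      have := hw i
      simp; omega
    rw [this]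
    simp
  | succ k ih =>
    have h1 : (Finset.univ.filter fun i => w i ≤ k + 1) = (Finset.univ.filter fun i => w i ≤ k) ∪
        Finset.univ.filter fun i => v i ≡ a + k + 1 [MOD n + 1] := by
      ext i
      simp only [Finset.mem_filter, Finset.mem_univ, true_and, Finset.mem_union]
      rw [Nat.le_succ_iff]
      refine or_congr_right ⟨fun he => ?_, fun he => ?_⟩
      · have := h i
        rw [he] at this
        rwa [show a + k + 1 = k.succ + a by omega]
      · have h2 : w i + a ≡ (k + 1) + a [MOD n + 1] := by
          rw [show k + 1 + a = a + k + 1 by omega]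
          exact (h i).symm.trans he
        have h3 := Nat.ModEq.add_right_cancel' a h2
        have h4 := hw i
        rw [show w i = (w i - 1) + 1 by omega] at h3
        have h5 := eq_of_modEq_of_mem (Nat.ModEq.add_right_cancel' 1 h3) (by omega) (by omega)
        omega
    have h2 : Disjoint (Finset.univ.filter fun i => w i ≤ k)
        (Finset.univ.filter fun i => v i ≡ a + k + 1 [MOD n + 1]) := by
      rw [Finset.disjoint_filter]
      intro i _ hik he
      have h2 : w i + a ≡ (k + 1) + a [MOD n + 1] := by
        rw [show k + 1 + a = a + k + 1 by omega]
        exact (h i).symm.trans he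
      have h3 := Nat.ModEq.add_right_cancel' a h2
      have h4 := hw i
      rw [show w i = (w i - 1) + 1 by omega] at h3
      have h5 := eq_of_modEq_of_mem (Nat.ModEq.add_right_cancel' 1 h3) (by omega) (by omega)
      omega
    rw [h1, Finset.card_union_of_disjoint h2, ← add_assoc a k 1]
    have h3 : cyclicCount v (a + k + 1) = cyclicCount v (a + k) +
        (Finset.univ.filter fun i => v i ≡ a + k + 1 [MOD n + 1]).card := Finset.sum_range_succ _ _
    rw [h3, ← ih (by omega)]
    omega

theorem exists_shift (v : Fin n → ℕ) (a : ℕ) :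
    ∃ w : Fin n → ℕ, (∀ i, 1 ≤ w i ∧ w i ≤ n + 1) ∧ (∀ i, v i ≡ w i + a [MOD n + 1]) := by
  -- Since `n ≡ -1`, the residue is that of `v i - a - 1`; adding one afterwards gives the
  -- representative in `[1, n + 1]`.
  refine ⟨fun i => (v i + n * a + n) % (n + 1) + 1, fun i =>
    ⟨Nat.le_add_left _ _, Nat.mod_lt _ (Nat.succ_pos n)⟩, fun i => ?_⟩
  · calc v i ≡ v i + (n + 1) * (a + 1) [MOD n + 1] := by simp [Nat.ModEq]
      _ = (v i + n * a + n) + 1 + a := by ring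
      _ ≡ (v i + n * a + n) % (n + 1) + 1 + a [MOD n + 1] :=
        (((Nat.mod_modEq _ _).symm).add_right 1).add_right a

theorem cyclicCount_add_period (v : Fin n → ℕ) (a : ℕ) :
    cyclicCount v (a + (n + 1)) = cyclicCount v a + n := by
  obtain ⟨w, hw, h⟩ := exists_shift v a
  rw [← card_add_cyclicCount h hw le_rfl, Finset.filter_true_of_mem fun i _ => (hw i).2]
  simp; omega

theorem mem_park_iff_cyclicCount {v w : Fin n → ℕ} {a : ℕ} (h : ∀ i, v i ≡ w i + a [MOD n + 1])
    (hw : ∀ i, 1 ≤ w i ∧ w i ≤ n + 1) :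
    w ∈ Park n ↔ ∀ k ≤ n, k + cyclicCount v a ≤ cyclicCount v (a + k) := by
  rw [park_iff]
  constructor
  · rintro ⟨-, h1⟩ k hk
    rw [← card_add_cyclicCount h hw (by omega)]
    have := h1 k hk
    omega
  · intro h1
    have h2 : ∀ k ≤ n, k ≤ (Finset.univ.filter fun i => w i ≤ k).card := fun k hk => by
      have h3 := h1 k hk
      rw [← card_add_cyclicCount h hw (by omega)] at h3
      omega
    refine ⟨fun i => ⟨(hw i).1, ?_⟩, h2⟩
    have h3 : (Finset.univ.filter fun i => w i ≤ n) = Finset.univ :=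
      Finset.eq_univ_of_card _ (le_antisymm (Finset.card_le_univ _) (by simpa using h2 n le_rfl))
    have := Finset.mem_univ i
    rw [← h3] at this
    simpa using this

/-- The cycle lemma: every orbit of words contains exactly one parking function. -/
theorem existsUnique_park (v : Fin n → ℕ) : ∃! w : Fin n → ℕ, w ∈ Park n ∧ SameOrbit v w := by
  classical
  -- `S` drops by one over each period, and the parking condition for the shift by `a` says that `S
  -- a` is minimal on `[a, a + n]`. The first minimum in a period has this property.
  let S : ℕ → ℤ := fun k => cyclicCount v k - k
  have hS : ∀ a, S (a + (n + 1)) = S a - 1 := fun a => by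
    simp only [S, cyclicCount_add_period]
    push_cast; ring
  have hiff : ∀ a, (∀ k ≤ n, k + cyclicCount v a ≤ cyclicCount v (a + k)) ↔
      ∀ k ≤ n, S a ≤ S (a + k) := fun a => by
    refine forall₂_congr fun k _ => ?_
    simp only [S]
    push_cast
    omega
  have hex : ∃ a, a ≤ n ∧ ∀ b ≤ n, S a ≤ S b := by
    obtain ⟨a, ha, h⟩ := Finset.exists_min_image (Finset.range (n + 1)) S ⟨0, by simp⟩
    exact ⟨a, by simpa [Nat.lt_succ_iff] using ha, fun b hb => h b (by simp; omega)⟩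
  obtain ⟨ha1, ha2⟩ := Nat.find_spec hex
  have hmin := fun b (hb : b < Nat.find hex) => Nat.find_min hex hb
  set a := Nat.find hex
  obtain ⟨w, hw, h⟩ := exists_shift v a
  have hwP : w ∈ Park n := by
    refine (mem_park_iff_cyclicCount h hw).2 ((hiff a).2 fun k hk => ?_)
    rcases le_or_gt (a + k) n with hak | hak
    · exact ha2 _ hak
    · have h1 := hmin (a + k - (n + 1)) (by omega)
      push Not at h1
      obtain ⟨b, hb1, hb2⟩ := h1 (by omega)
      have h2 := ha2 b hb1
      have h3 := hS (a + k - (n + 1))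
      rw [Nat.sub_add_cancel (by omega)] at h3
      omega
  have hvw : SameOrbit v w := SameOrbit.symm ⟨a, fun i => (h i).symm⟩
  refine ⟨w, ⟨hwP, hvw⟩, ?_⟩
  · have key : ∀ u : Fin n → ℕ, u ∈ Park n → SameOrbit v u →
        ∃ b ≤ n, (∀ i, v i ≡ u i + b [MOD n + 1]) ∧ ∀ k ≤ n, S b ≤ S (b + k) := by
      intro u hu hvu
      obtain ⟨c, hc⟩ := hvu.symm
      have hb : ∀ i, v i ≡ u i + c % (n + 1) [MOD n + 1] := fun i =>
        (hc i).symm.trans ((Nat.mod_modEq _ _).symm.add_left _)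
      refine ⟨c % (n + 1), Nat.lt_succ_iff.1 (Nat.mod_lt _ (Nat.succ_pos n)), hb, ?_⟩
      exact (hiff _).1 ((mem_park_iff_cyclicCount hb fun i =>
        ⟨(hu.1 i).1, (hu.1 i).2.trans (Nat.le_succ n)⟩).1 hu)
    -- Two such starting points would give `S b ≤ S c ≤ S (b + n + 1) = S b - 1`.
    have hlt : ∀ b c, b < c → c ≤ n → (∀ k ≤ n, S b ≤ S (b + k)) →
        (∀ k ≤ n, S c ≤ S (c + k)) → False := by
      intro b c hbc hc h1 h2
      have h3 := h1 (c - b) (by omega)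
      have h4 := h2 (b + (n + 1) - c) (by omega)
      rw [show b + (c - b) = c by omega] at h3
      rw [show c + (b + (n + 1) - c) = b + (n + 1) by omega, hS] at h4
      omega
    rintro u ⟨hu, hvu⟩
    obtain ⟨b, hb, hb1, hb2⟩ := key u hu hvu
    obtain ⟨c, hc, hc1, hc2⟩ := key w hwP hvw
    have hbc : b = c := by
      rcases lt_trichotomy b c with hlt' | he | hlt'
      · exact (hlt b c hlt' hc hb2 hc2).elim
      · exact he
      · exact (hlt c b hlt' hb hc2 hb2).elim
    subst hbc
    ext i
    exact eq_of_modEq_of_mem (Nat.ModEq.add_right_cancel' b ((hb1 i).symm.trans (hc1 i)))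
      (hu.1 i).2 (hwP.1 i).2

theorem beta_spec (v : Fin n → ℕ) : beta v ∈ Park n ∧ SameOrbit v (beta v) :=
  Classical.epsilon_spec (existsUnique_park v).exists

theorem beta_eq_of_park {v w : Fin n → ℕ} (hw : w ∈ Park n) (h : SameOrbit v w) : beta v = w :=
  (existsUnique_park v).unique (beta_spec v) ⟨hw, h⟩

theorem beta_of_park {w : Fin n → ℕ} (hw : w ∈ Park n) : beta w = w :=
  beta_eq_of_park hw ⟨0, fun _ => rfl⟩

/-- Going down cyclically from the first letter, let `d` be the number of steps to the first residue
that is not a letter. The shift sending that residue to `0` makes the first letter `d`, and all of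
`[1, d]` occur. -/
theorem exists_rook [NeZero n] (p : Fin n → ℕ) : ∃ v ∈ Rook n, SameOrbit p v := by
  classical
  -- The `n` letters cannot cover all `n + 1` residues.
  have hex : ∃ d, d ≤ n ∧ ∀ i, ¬ p i + d ≡ p 0 [MOD n + 1] := by
    by_contra hcon
    push Not at hcon
    choose! f hf using hcon
    have hinj : Function.Injective fun d : Fin (n + 1) => f d := by
      intro a b hab
      have h1 := hf a (by omega)
      have h2 := hf b (by omega)
      simp only at hab
      rw [← hab] at h2
      exact Fin.ext (eq_of_modEq_of_mem (Nat.ModEq.add_left_cancel' _ (h1.trans h2.symm))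
        (by omega) (by omega))
    have := Fintype.card_le_of_injective _ hinj
    simp at this
  obtain ⟨hd1, hd2⟩ := Nat.find_spec hex
  have hmin := fun b (hb : b < Nat.find hex) => Nat.find_min hex hb
  set d := Nat.find hex
  have hd0 : 1 ≤ d := by
    by_contra h0
    have h0' : d = 0 := by omega
    exact hd2 0 (by rw [h0', add_zero])
  let v : Fin n → ℕ := fun i => (p i + n * p 0 + d) % (n + 1)
  have hvn : ∀ i, v i ≤ n := fun i => Nat.lt_succ_iff.1 (Nat.mod_lt _ (Nat.succ_pos n))
  have hv : ∀ i, v i + p 0 ≡ p i + d [MOD n + 1] := fun i =>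
    calc v i + p 0 ≡ p i + n * p 0 + d + p 0 [MOD n + 1] := (Nat.mod_modEq _ _).add_right _
      _ = p i + d + (n + 1) * p 0 := by ring
      _ ≡ p i + d [MOD n + 1] := by simp [Nat.ModEq]
  have hv0 : v 0 = d := by
    refine eq_of_modEq_of_mem (Nat.ModEq.add_right_cancel' (p 0) ?_) (hvn 0) hd1
    rw [add_comm d]
    exact hv 0
  refine ⟨v, ⟨fun i => ⟨?_, hvn i⟩, fun a ha ha0 => ?_⟩, n * p 0 + d, fun i => ?_⟩
  · by_contra h0
    have h0' : v i = 0 := by omega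
    have := hv i
    rw [h0', zero_add] at this
    exact hd2 i this.symm
  · rw [hv0] at ha0
    have h1 := hmin (d - a) (by omega)
    push Not at h1
    obtain ⟨i, hi⟩ := h1 (by omega)
    refine ⟨i, eq_of_modEq_of_mem (Nat.ModEq.add_right_cancel' (p 0) ((hv i).trans ?_)) (hvn i)
      (by omega)⟩
    have h2 := hi.add_right a
    rw [show p i + (d - a) + a = p i + d by omega] at h2
    rwa [add_comm a]
  · rw [← add_assoc]
    exact (Nat.mod_modEq _ _).symm

/-- If `v 0 < w 0`, the letter `w 0 - v 0` occurs in `w`, and shifting back to `v` turns it into the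
residue `0`, which is not a letter. -/
theorem rook_unique [NeZero n] {v w : Fin n → ℕ} (hv : v ∈ Rook n) (hw : w ∈ Rook n)
    (h : SameOrbit v w) : v = w := by
  have key : ∀ {v w : Fin n → ℕ}, v ∈ Rook n → w ∈ Rook n → SameOrbit v w → ¬ v 0 < w 0 := by
    rintro v w hv hw ⟨c, hc⟩ hlt
    obtain ⟨i, hi⟩ := hw.2 (w 0 - v 0) (by omega) (by omega)
    have h1 := hc i
    rw [hi] at h1
    have h2 := (h1.add_right (v 0)).trans (by
      rw [Nat.sub_add_cancel hlt.le] : w 0 - v 0 + v 0 ≡ w 0 [MOD n + 1])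
    have h3 : v i + (v 0 + c) ≡ 0 + (v 0 + c) [MOD n + 1] := by
      rw [zero_add, show v i + (v 0 + c) = v i + c + v 0 by omega]
      exact h2.trans (hc 0).symm
    have h4 := eq_of_modEq_of_mem (Nat.ModEq.add_right_cancel' _ h3) (hv.1 i).2 (Nat.zero_le n)
    have := (hv.1 i).1
    omega
  have h0 : v 0 = w 0 := le_antisymm (not_lt.1 (key hw hv h.symm)) (not_lt.1 (key hv hw h))
  obtain ⟨c, hc⟩ := h
  have hc0 : c ≡ 0 [MOD n + 1] := by
    have := hc 0
    rw [← h0] at this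
    exact Nat.ModEq.add_left_cancel' (v 0) this
  ext i
  refine eq_of_modEq_of_mem ?_ (hv.1 i).2 (hw.1 i).2
  exact (hc0.add_left (v i)).symm.trans (hc i)

theorem arcsIn_congr {G : SimpleGraph (Fin n)} {v w : Fin n → ℕ}
    (h : Setoid.ker v = Setoid.ker w) : ArcsIn G v ↔ ArcsIn G w := by
  unfold ArcsIn
  rw [h]

/-- A cyclic shift preserves equality of letters; this is why ceiling partitions survive β. -/
theorem ker_beta {v : Fin n → ℕ} (hv : ∀ i, v i ≤ n) : Setoid.ker (beta v) = Setoid.ker v :=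
  ((beta_spec v).2.ker_eq hv fun i => ((beta_spec v).1.1 i).2).symm

theorem beta_bijOn [NeZero n] (G : SimpleGraph (Fin n)) :
    BijOn beta {w | w ∈ Rook n ∧ ArcsIn G w} {w | w ∈ Park n ∧ ArcsIn G w} := by
  refine ⟨?_, ?_, ?_⟩
  · rintro v ⟨hv, hG⟩
    exact ⟨(beta_spec v).1, (arcsIn_congr (ker_beta fun i => (hv.1 i).2)).2 hG⟩
  · rintro v ⟨hv, -⟩ w ⟨hw, -⟩ he
    refine rook_unique hv hw ((beta_spec v).2.trans ?_)
    rw [he]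
    exact (beta_spec w).2.symm
  · rintro p ⟨hp, hG⟩
    obtain ⟨v, hv, hpv⟩ := exists_rook p
    have hbeta := beta_eq_of_park hp hpv.symm
    refine ⟨v, ⟨hv, ?_⟩, hbeta⟩
    rwa [← arcsIn_congr (ker_beta fun i => (hv.1 i).2), hbeta]

/-! ### Bijectivity of ρ̂. -/

theorem rhoHat_cell [NeZero n] {G : SimpleGraph (Fin n)} {x : Fin n → ℝ}
    (hx : Generic (ishIdx G) x) : rhoHat G (cell (ishIdx G) x) =
      placement (IshCeil G x) fun j => (pos (cell (ishIdx G) x) j : ℕ) + 1 := by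
  have hrow : ∀ j : Fin n, (∀ i, IshCeil G x i j →
      (if ishDots G (cell (ishIdx G) x) ((regionPerm (cell (ishIdx G) x)).symm j) = 0 then
        (((regionPerm (cell (ishIdx G) x)).symm j : Fin n) : ℕ) + 1
      else n + ishDots G (cell (ishIdx G) x) ((regionPerm (cell (ishIdx G) x)).symm j)) =
        n + ((i : ℕ) + 1)) ∧ (IsRoot (IshCeil G x) j →
      (if ishDots G (cell (ishIdx G) x) ((regionPerm (cell (ishIdx G) x)).symm j) = 0 then
        (((regionPerm (cell (ishIdx G) x)).symm j : Fin n) : ℕ) + 1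
      else n + ishDots G (cell (ishIdx G) x) ((regionPerm (cell (ishIdx G) x)).symm j)) =
        (pos (cell (ishIdx G) x) j : ℕ) + 1) := by
    refine fun j => ⟨fun i hi => ?_, fun hj => ?_⟩
    · rw [ishDots_of_ishCeil hx hi, if_neg (Nat.succ_ne_zero _)]
    · rw [ishDots_of_isRoot hx hj, if_pos rfl]; rfl
  ext p
  constructor
  · rintro ⟨j, rfl⟩
    by_cases hj : IsRoot (IshCeil G x) j
    · exact Or.inr ⟨j, hj, by rw [(hrow j).2 hj]⟩
    · simp only [IsRoot, not_forall, not_not] at hj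
      obtain ⟨i, hi⟩ := hj
      exact Or.inl ⟨i, j, hi, by rw [(hrow j).1 i hi]⟩
  · rintro (⟨i, j, hij, rfl⟩ | ⟨j, hj, rfl⟩)
    · exact ⟨j, by rw [(hrow j).1 i hij]⟩
    · exact ⟨j, by rw [(hrow j).2 hj]⟩

theorem placementData_cell [NeZero n] {G : SimpleGraph (Fin n)} {x : Fin n → ℝ}
    (hx : Generic (ishIdx G) x) :
    PlacementData G (IshCeil G x) fun j => (pos (cell (ishIdx G) x) j : ℕ) + 1 where
  arc := arcRel_ishCeil
  adj _ _ h := h.adj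
  one_le _ _ := Nat.le_add_left _ _
  le j _ := (pos (cell (ishIdx G) x) j).2
  inj i j _ _ he := (pos (cell (ishIdx G) x)).injective (Fin.ext (by simpa using he))
  -- A letter bounded by a ceiling has its coordinate below `x 0`, so every position before that of
  -- the letter 1 is held by a block minimum.
  fill a ha ha0 := by
    have hlt : a - 1 < (pos (cell (ishIdx G) x) 0 : ℕ) := by omega
    refine ⟨(pos (cell (ishIdx G) x)).symm ⟨a - 1, by omega⟩, fun i hi => ?_, ?_⟩
    · have h1 := (pos_lt_iff (coxIdx_subset_ishIdx G) hx).2 hi.pos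
      rw [Equiv.apply_symm_apply] at h1
      exact lt_asymm hlt h1
    · rw [Equiv.apply_symm_apply]
      exact Nat.sub_add_cancel ha

theorem rhoHat_injOn [NeZero n] (G : SimpleGraph (Fin n)) :
    InjOn (rhoHat G) (regions (ish G)) := by
  rw [ish_eq_arr, regions_arr]
  rintro _ ⟨x, hx, rfl⟩ _ ⟨y, hy, rfl⟩ hxy
  have hT := coxIdx_subset_ishIdx G
  rw [rhoHat_cell hx, rhoHat_cell hy] at hxy
  obtain ⟨hceil, hroot⟩ := (placementData_cell hx).congr_of_eq (placementData_cell hy) hxy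
  have hpos : pos (cell (ishIdx G) x) = pos (cell (ishIdx G) y) := by
    refine (arcRel_ishCeil (G := G) (x := x)).increasing_unique ?_ ?_ ?_
    · exact fun i hi => Fin.ext (by simpa using hroot i hi)
    · exact fun i j i' j' h h' hlt => (pos_lt_iff hT hx).2 (h.increasing h' hlt)
    · intro i j i' j' h h' hlt
      rw [hceil] at h h'
      exact (pos_lt_iff hT hy).2 (h.increasing h' hlt)
  have hlt : ∀ a b, x a < x b ↔ y a < y b := fun a b => by
    rw [← pos_lt_iff hT hx, hpos, pos_lt_iff hT hy]
  have hle : ∀ a b, x a ≤ x b ↔ y a ≤ y b := fun a b => by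
    rw [← pos_le_iff hT hx, hpos, pos_le_iff hT hy]
  refine (cell_eq_of_mem ((mem_cell_iff hx hy).2 ?_)).symm
  rintro ⟨a, b, c⟩ (⟨hab, rfl⟩ | ⟨a, b, hab, hG, ht⟩)
  · simpa [ev] using hlt a b
  · rw [ht]
    simp only [ev, sub_neg]
    have hxi := hx.injective hT
    rcases lt_or_gt_of_ne (hxi.ne (zero_ne_of_lt hab)) with h | h
    · have h' := (hlt _ _).1 h
      have : (0 : ℝ) < a + 1 := by positivity
      exact iff_of_true (by linarith) (by linarith)
    · have h' := (hlt _ _).1 h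
      rw [below_iff_exists_ishCeil hxi hab hG h,
        below_iff_exists_ishCeil (hy.injective hT) hab hG h', hceil]
      simp only [hle]

theorem rhoHat_surjOn [NeZero n] (G : SimpleGraph (Fin n)) :
    SurjOn (rhoHat G) (regions (ish G)) (validPlacements G) := by
  classical
  rw [ish_eq_arr, regions_arr]
  intro P hP
  obtain ⟨r, f, h, rfl⟩ := exists_placementData hP
  have hT := coxIdx_subset_ishIdx G
  have h0 := h.arc.isRoot_zero
  -- Rows count from one and positions from zero; the value `0` on non-minima is never used.
  obtain ⟨Q, hQ1, hQ2⟩ := h.arc.exists_increasing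
    (f := fun j => if hj : IsRoot r j then
      (⟨f j - 1, by have := h.one_le j hj; have := h.le j hj; omega⟩ : Fin n) else 0) (by
      intro i j hi hj he
      simp only [hi, hj, dif_pos, Fin.mk.injEq] at he
      have := h.one_le i hi
      have := h.one_le j hj
      exact h.inj i j hi hj (by omega))
  have hQf : ∀ j, IsRoot r j → (Q j : ℕ) + 1 = f j := fun j hj => by
    rw [hQ1 j hj, dif_pos hj]
    exact Nat.sub_add_cancel (h.one_le j hj)
  -- By `fill`, block minima already hold all positions before that of the letter 1. Ceilings need
  -- this, since they only bound coordinates below `x 0`.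
  have hQ0 : ∀ i j, r i j → Q 0 < Q j := by
    intro i j hij
    by_contra hge
    rcases (not_lt.1 hge).eq_or_lt with he | hlt
    · have := Q.injective he
      subst this
      exact h0 i hij
    · have hlt' : (Q j : ℕ) < Q 0 := hlt
      have h1 := hQf 0 h0
      obtain ⟨k, hk, hfk⟩ := h.fill ((Q j : ℕ) + 1) (by omega) (by omega)
      have h2 := hQf k hk
      have : k = j := Q.injective (Fin.ext (by omega))
      subst this
      exact hk i hij
  have hyinj : Function.Injective fun k => -((Q k : ℕ) : ℝ) := by
    intro a b hab
    have h1 : ((Q a : ℕ) : ℝ) = (Q b : ℕ) := neg_injective hab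
    exact Q.injective (Fin.ext (by exact_mod_cast h1))
  obtain ⟨x, hx1, hx2⟩ := exists_realization_ish hyinj r
  have hx1 : ∀ a b, x b < x a ↔ Q a < Q b := fun a b => by
    rw [hx1, neg_lt_neg_iff, Nat.cast_lt]; rfl
  have hle : ∀ a b, x b ≤ x a ↔ Q a ≤ Q b := fun a b => by
    rw [← not_lt, hx1, not_lt]
  have hx2 : ∀ k, x k < x 0 → ∀ i : Fin n, x 0 - x k ≠ i + 1 ∧
      (x 0 - x k < i + 1 ↔ ∃ i' k', r i' k' ∧ x k' ≤ x k ∧ i' ≤ i) := fun k hk i => by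
    have := hx2 k (by rw [neg_lt_neg_iff, Nat.cast_lt]; exact (hx1 _ _).1 hk) i
    refine ⟨this.1, this.2.trans (exists₂_congr fun i' k' => ?_)⟩
    rw [hle, neg_le_neg_iff, Nat.cast_le]
    rfl
  have hinj : Function.Injective x := fun a b hab =>
    Q.injective (le_antisymm ((hle _ _).1 hab.ge) ((hle _ _).1 hab.le))
  have hx : Generic (ishIdx G) x := by
    refine generic_ishIdx_iff.2 ⟨hinj, fun i j hij _ he => ?_⟩
    have h1 : (0 : ℝ) < i + 1 := by positivity
    exact (hx2 j (by linarith) i).1 he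
  have hpos := pos_eq_of_lt_iff hT hx hx1
  have hr0 : ∀ {i j}, r i j → x j < x 0 := fun {i j} hij => (hx1 _ _).2 (hQ0 i j hij)
  have hbelow : ∀ {i j}, r i j → x 0 - x j < i + 1 := fun {i j} hij =>
    (hx2 j (hr0 hij) i).2.2 ⟨i, j, hij, le_rfl, le_rfl⟩
  have hceil : IshCeil G x = r := by
    ext i j
    constructor
    · intro hc
      obtain ⟨i', j', h', hj, hi⟩ := (hx2 j hc.pos i).2.1 hc.below
      rcases hc.max i' j' (h.arc.lt h') (h.adj _ _ h') (hbelow h') hj with hlt | ⟨rfl, rfl⟩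
      · exact absurd hlt hi.not_gt
      · exact h'
    · intro hij
      refine ⟨h.arc.lt hij, h.adj _ _ hij, hr0 hij, hbelow hij, ?_⟩
      intro i' k hik hG hb hk
      obtain ⟨i'', k'', h'', hk'', hi''⟩ := (hx2 k (hk.trans_lt (hr0 hij)) i').2.1 hb
      rcases lt_trichotomy i i'' with hlt | rfl | hlt
      · exact Or.inl (hlt.trans_le hi'')
      · rcases hi''.eq_or_lt with rfl | hlt
        · have := h.arc.right hij h''
          subst this
          exact Or.inr ⟨rfl, hinj (le_antisymm hk hk'')⟩
        · exact Or.inl hlt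
      · have h1 := hQ2 _ _ _ _ h'' hij hlt
        have h2 := (hle _ _).1 (hk''.trans hk)
        exact absurd h1 h2.not_gt
  refine ⟨_, ⟨x, hx, rfl⟩, ?_⟩
  rw [rhoHat_cell hx, hceil, hpos]
  exact placement_congr hQf

theorem rhoHat_bijOn [NeZero n] (G : SimpleGraph (Fin n)) :
    BijOn (rhoHat G) (regions (ish G)) (validPlacements G) := by
  refine ⟨?_, rhoHat_injOn G, rhoHat_surjOn G⟩
  rw [ish_eq_arr, regions_arr]
  rintro _ ⟨x, hx, rfl⟩
  rw [rhoHat_cell hx]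
  exact (placementData_cell hx).mem_validPlacements

/-! ### The composition, ceiling partitions and dominance. -/

theorem ishToShi_bijOn [NeZero n] (G : SimpleGraph (Fin n)) :
    BijOn (ishToShi G) (regions (ish G)) (regions (shi G)) := by
  have h1 : BijOn (omega G) {w | w ∈ Park n ∧ ArcsIn G w} (regions (shi G)) :=
    BijOn.symm (shiWord_bijOn G).invOn_invFunOn.symm (shiWord_bijOn G)
  exact h1.comp ((beta_bijOn G).comp ((laserWord_bijOn G).comp (rhoHat_bijOn G)))

theorem shiWord_ishToShi [NeZero n] {G : SimpleGraph (Fin n)} {R : Set (Fin n → ℝ)}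
    (hR : R ∈ regions (ish G)) :
    shiWord G (ishToShi G R) = beta (laserWord (rhoHat G R)) := by
  have h := ((beta_bijOn G).comp ((laserWord_bijOn G).comp (rhoHat_bijOn G))).mapsTo hR
  exact (shiWord_bijOn G).invOn_invFunOn.2 h

theorem mem_park_of_le {w : Fin n → ℕ} (h : ∀ i, 1 ≤ w i ∧ w i ≤ (i : ℕ) + 1) :
    w ∈ Park n := by
  refine park_iff.2 ⟨fun i => ⟨(h i).1, (h i).2.trans i.2⟩, fun k hk => ?_⟩
  calc k = (Finset.univ.map (Fin.castLEEmb hk)).card := by simp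
    _ ≤ _ := Finset.card_le_card fun i hi => by
      simp only [Finset.mem_map, Finset.mem_univ, true_and] at hi
      obtain ⟨a, rfl⟩ := hi
      simp only [Finset.mem_filter, Finset.mem_univ, true_and]
      refine (h _).2.trans ?_
      simp

/-- When either permutation is the identity, the corresponding word is both a rook word and a
parking function, so β does not move it and the block minima on the other side carry their own
numbers. Under the identity, being ordered by predecessor position and by predecessor number mean
the same, so uniqueness of diagrams makes the other permutation the identity. -/
theorem pos_eq_one_iff [NeZero n] {G : SimpleGraph (Fin n)} {x y : Fin n → ℝ}
    (hx : Generic (ishIdx G) x) (hy : Generic (shiIdx G) y)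
    (h : shiWord G (cell (shiIdx G) y) = beta (laserWord (rhoHat G (cell (ishIdx G) x)))) :
    pos (cell (shiIdx G) y) = 1 ↔ pos (cell (ishIdx G) x) = 1 := by
  have hTx := coxIdx_subset_ishIdx G
  have hTy := coxIdx_subset_shiIdx G
  have hd := placementData_cell hx
  rw [rhoHat_cell hx] at h
  set v := laserWord (n := n)
    (placement (IshCeil G x) fun j => (pos (cell (ishIdx G) x) j : ℕ) + 1) with hv
  obtain ⟨hv1, hv2⟩ := hd.laserWord_spec
  obtain ⟨hvR, -⟩ := hd.laserWord_mem
  rw [← hv] at hv1 hv2 hvR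
  have hceil : ShiCeil G y = IshCeil G x := by
    rw [← isArc_ker_shiWord hy, h, ker_beta fun i => (hvR.1 i).2, hd.isArc_ker_laserWord]
  have hle : ∀ {r : Fin n → Fin n → Prop} {w : Fin n → ℕ}, ArcRel r →
      (∀ i j, r i j → w i = w j) → (∀ i, IsRoot r i → w i = (i : ℕ) + 1) →
      ∀ j, 1 ≤ w j ∧ w j ≤ (j : ℕ) + 1 := by
    intro r w hr h1 h2 j
    obtain ⟨i, hi, hij⟩ := hr.exists_root j
    rw [← eq_of_reflTransGen h1 hij, h2 i hi]
    have : (i : ℕ) ≤ j := hr.le_of_reflTransGen hij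
    omega
  constructor
  · intro hone
    have hyr : ∀ i, IsRoot (ShiCeil G y) i →
        shiWord G (cell (shiIdx G) y) i = (i : ℕ) + 1 := fun i hi => by
      rw [shiWord_of_isRoot hy i hi, hone]; rfl
    have hp := hle arcRel_shiCeil (shiWord_eq_of_shiCeil hy) hyr
    have hp0 : shiWord G (cell (shiIdx G) y) 0 = 1 := by
      have := hp 0
      simp only [Fin.val_zero] at this
      omega
    -- The first letter is `1`, so the rook condition asks only for the letter `1`.
    have hpR : shiWord G (cell (shiIdx G) y) ∈ Rook n :=
      ⟨(shiWord_mem hy).1.1, fun a ha ha0 => ⟨0, by omega⟩⟩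
    have hvp : v = shiWord G (cell (shiIdx G) y) :=
      rook_unique hvR hpR (h ▸ (beta_spec v).2)
    refine (arcRel_ishCeil (G := G) (x := x)).increasing_unique ?_ ?_ ?_
    · intro i hi
      have h1 := hv2 i hi
      rw [hvp, hyr i (hceil ▸ hi)] at h1
      exact Fin.ext (by simpa using h1.symm)
    · exact fun i j i' j' h h' hlt => (pos_lt_iff hTx hx).2 (h.increasing h' hlt)
    · intro i j i' j' h1 h2 hlt
      rw [← hceil] at h1 h2
      have h4 : ∀ a b, y b < y a ↔ a < b := fun a b => by
        rw [← pos_lt_iff hTy hy, hone]; rfl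
      exact (h4 _ _).1 (h1.nonnesting h2 ((h4 _ _).2 hlt))
  · intro hone
    have hvr : ∀ i, IsRoot (IshCeil G x) i → v i = (i : ℕ) + 1 := fun i hi => by
      rw [hv2 i hi, hone]; rfl
    have hvp := mem_park_of_le (hle arcRel_ishCeil hv1 hvr)
    rw [beta_of_park hvp] at h
    refine (arcRel_shiCeil (G := G) (x := y)).nonnesting_unique ?_ ?_ ?_ ?_ ?_
    · intro i hi
      have h1 := shiWord_of_isRoot hy i hi
      rw [h, hvr i (hceil ▸ hi)] at h1
      exact Fin.ext (by simpa using h1.symm)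
    · exact fun i j h => (pos_lt_iff hTy hy).2 h.pos
    · exact fun i j h => h.lt
    · exact fun i j i' j' h h' hlt =>
        (pos_lt_iff hTy hy).2 (h.nonnesting h' ((pos_lt_iff hTy hy).1 hlt))
    · intro i j i' j' h1 h2 hlt
      rw [hceil] at h1 h2
      have h3 := (pos_lt_iff hTx hx).2 (h1.increasing h2 hlt)
      rwa [hone] at h3

theorem ishToShi_preserves [NeZero n] {G : SimpleGraph (Fin n)} {R : Set (Fin n → ℝ)}
    (hR : R ∈ regions (ish G)) :
    shiCeilingPartition G (ishToShi G R) = ishCeilingPartition G R ∧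
      (IsDominant (ishToShi G R) ↔ IsDominant R) := by
  have hword := shiWord_ishToShi hR
  have hS := (ishToShi_bijOn G).mapsTo hR
  rw [ish_eq_arr, regions_arr] at hR
  rw [shi_eq_arr, regions_arr] at hS
  obtain ⟨x, hx, rfl⟩ := hR
  obtain ⟨y, hy, hSy⟩ := hS
  rw [hSy] at hword ⊢
  constructor
  · rw [shiCeilingPartition_cell hy, ishCeilingPartition_cell hx, ← ker_shiWord hy, hword,
      rhoHat_cell hx, ker_beta fun i => ((placementData_cell hx).laserWord_mem.1.1 i).2,
      (placementData_cell hx).ker_laserWord]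
  · have hone : ∀ R : Set (Fin n → ℝ), regionPerm R = 1 ↔ pos R = 1 := fun R => by
      constructor
      · intro h; rw [pos, h]; rfl
      · intro h
        exact Equiv.ext fun a => ((Equiv.symm_apply_eq _).1 (DFunLike.congr_fun h a)).symm
    rw [isDominant_cell_iff (coxIdx_subset_shiIdx G) hy,
      isDominant_cell_iff (coxIdx_subset_ishIdx G) hx, hone, hone]
    exact pos_eq_one_iff hx hy hword

end ShiIsh

theorem mainTheorem2 (n : ℕ) [NeZero n] (G : SimpleGraph (Fin n)) :
    -- the maps `ρ̂`, `λ`, `β` and the labelling inverse to `ω` are bijections between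
    -- the intermediate objects, so that the composition is well defined
    Set.BijOn (ShiIsh.rhoHat G) (ShiIsh.regions (ShiIsh.ish G)) (ShiIsh.validPlacements G) ∧
    Set.BijOn ShiIsh.laserWord (ShiIsh.validPlacements G)
      {w | w ∈ ShiIsh.Rook n ∧ ShiIsh.ArcsIn G w} ∧
    (∀ v ∈ ShiIsh.Rook n, ∃! w : Fin n → ℕ, w ∈ ShiIsh.Park n ∧ ShiIsh.SameOrbit v w) ∧
    Set.BijOn ShiIsh.beta {w | w ∈ ShiIsh.Rook n ∧ ShiIsh.ArcsIn G w}
      {w | w ∈ ShiIsh.Park n ∧ ShiIsh.ArcsIn G w} ∧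
    Set.BijOn (ShiIsh.shiWord G) (ShiIsh.regions (ShiIsh.shi G))
      {w | w ∈ ShiIsh.Park n ∧ ShiIsh.ArcsIn G w} ∧
    -- the composition is a bijection that preserves ceiling partitions and dominance
    Set.BijOn (ShiIsh.ishToShi G) (ShiIsh.regions (ShiIsh.ish G))
      (ShiIsh.regions (ShiIsh.shi G)) ∧
    ∀ R ∈ ShiIsh.regions (ShiIsh.ish G),
      ShiIsh.shiCeilingPartition G (ShiIsh.ishToShi G R) = ShiIsh.ishCeilingPartition G R ∧
      (ShiIsh.IsDominant (ShiIsh.ishToShi G R) ↔ ShiIsh.IsDominant R) :=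
  ⟨ShiIsh.rhoHat_bijOn G, ShiIsh.laserWord_bijOn G, fun v _ => ShiIsh.existsUnique_park v,
    ShiIsh.beta_bijOn G, ShiIsh.shiWord_bijOn G, ShiIsh.ishToShi_bijOn G,
    fun _ hR => ShiIsh.ishToShi_preserves hR⟩
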